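/- Let $C\subset\mathbb{R}^n$ be a closed convex set with nonempty interior and let $x\in\mathbb{R}^n\setminus C$. Write $p=\operatorname{proj}_C(x)$ for the metric projection of $x$ onto $C$, $d=d_C(x)=\|x-p\|>0$, $\nu=(x-p)/d$, and for $\delta>0$ $$p_\delta(x)=\frac{\mathbb{E}[Y\mathbf 1_C(Y)]}{\mathbb{E}[\mathbf 1_C(Y)]}=\mathbb{E}[Y\mid Y\in C],\qquad Y\sim\mathcal N(x,\delta I).$$ Assume that $\partial C$ admits a local $C^{2,1}$ chart at $p$ with constants $(\rho,L,M)$, where $\rho>0$ and $M\ge 0$. This means: $p\in\partial C$ and, after a rigid motion sending $p$ to $0$ and the outward unit normal at $p$ to $e_n$, there is a concave $C^2$ function $h$ on the ball $B_\rho=\{z\in\mathbb{R}^{n-1}:\|z\|<\rho\}$ with $h(0)=0$, $\nabla h(0)=0$, $\|\nabla^2h(z)\|\le L$ and $\|\nabla^2h(z)-\nabla^2h(z')\|\le M\|z-z'\|$ for all $z,z'\in B_\rho$, such that $$C\cap\big(B_\rho\times(-\rho,\rho)\big)=\{(z,t)\in B_\rho\times(-\rho,\rho):\ t\le h(z)\}.$$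 Then there are $\delta_0>0$ and constants $K,K_\nu,K_\tau$ (independent of $\delta$) such that for every $0<\delta<\delta_0$ $$\|p_\delta(x)-p\|\le K\delta ,$$ $$|\langle \nu, p_\delta(x)-p\rangle|\le\Big(\frac{L(n-1)}{2}+\frac1d\Big)\delta+K_\nu\,\delta^{3/2},$$ $$\big\|(p_\delta(x)-p)-\langle \nu,p_\delta(x)-p\rangle\,\nu\big\|\le\frac{M(n^2-1)d}{6}\,\delta+K_\tau\,\delta^{2}.$$ -/

import Mathlib

open MeasureTheory ProbabilityTheory Set

/-- `p` is a point of `C` at minimal distance from `x`. -/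
def IsNearestPoint {n : ℕ} (C : Set (EuclideanSpace ℝ (Fin n))) (x p : EuclideanSpace ℝ (Fin n)) :
    Prop :=
  p ∈ C ∧ dist x p = Metric.infDist x C

/-- The metric projection of `x` onto `C`. For a nonempty closed convex set this is the unique
nearest point, see `isNearestPoint_iff_eq_metricProj`. -/
noncomputable def metricProj {n : ℕ} (C : Set (EuclideanSpace ℝ (Fin n)))
    (x : EuclideanSpace ℝ (Fin n)) : EuclideanSpace ℝ (Fin n) :=
  Classical.epsilon (IsNearestPoint C x)

theorem isNearestPoint_metricProj {n : ℕ} {C : Set (EuclideanSpace ℝ (Fin n))}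
    (hC : IsClosed C) (hne : C.Nonempty) (x : EuclideanSpace ℝ (Fin n)) :
    IsNearestPoint C x (metricProj C x) := by
  obtain ⟨y, hy, hxy⟩ := hC.exists_infDist_eq_dist hne x
  exact Classical.epsilon_spec (p := IsNearestPoint C x) ⟨y, hy, hxy.symm⟩

theorem isNearestPoint_iff_eq_metricProj {n : ℕ} {C : Set (EuclideanSpace ℝ (Fin n))}
    (hC : IsClosed C) (hconv : Convex ℝ C) (hne : C.Nonempty)
    (x p : EuclideanSpace ℝ (Fin n)) :
    IsNearestPoint C x p ↔ p = metricProj C x := by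
  have hq := isNearestPoint_metricProj hC hne x
  refine ⟨fun hp => ?_, fun h => h ▸ hq⟩
  have key : ∀ q, IsNearestPoint C x q → ∀ w ∈ C, inner ℝ (x - q) (w - q) ≤ 0 := by
    intro q hq'
    refine (norm_eq_iInf_iff_real_inner_le_zero hconv hq'.1).1 ?_
    rw [← dist_eq_norm, hq'.2, Metric.infDist_eq_iInf]
    simp only [dist_eq_norm]
  set q := metricProj C x
  have h1 := key p hp q hq.1
  have h2 := key q hq p hp.1
  have h3 : inner ℝ (p - q) (p - q) ≤ (0 : ℝ) := by
    have e1 : inner ℝ (x - p) (q - p) = inner ℝ (p - x) (p - q) := by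
      rw [← neg_sub p x, ← neg_sub p q, inner_neg_neg]
    have e2 : p - q = (p - x) + (x - q) := by abel
    rw [e1] at h1
    conv_lhs => rw [e2, inner_add_left]
    rw [← e2]
    linarith
  exact sub_eq_zero.1 (inner_self_eq_zero (𝕜 := ℝ).1 (le_antisymm h3 real_inner_self_nonneg))

/-- The smoothed projection `E[Y | Y ∈ C]`, where `Y` has law `N(x, δ I)`, written as
`E[Y 1_C(Y)] / E[1_C(Y)]`. -/
noncomputable def smoothedProj {n : ℕ} (C : Set (EuclideanSpace ℝ (Fin n))) (δ : ℝ)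
    (x : EuclideanSpace ℝ (Fin n)) : EuclideanSpace ℝ (Fin n) :=
  (∫ y, C.indicator (fun _ => (1 : ℝ)) y
      ∂(multivariateGaussian x (δ • (1 : Matrix (Fin n) (Fin n) ℝ))))⁻¹ •
    ∫ y, C.indicator (fun y => y) y
      ∂(multivariateGaussian x (δ • (1 : Matrix (Fin n) (Fin n) ℝ)))

/-- `ν` is an outward unit normal vector to the convex set `C` at `p`. -/
def IsOutwardUnitNormal {n : ℕ} (C : Set (EuclideanSpace ℝ (Fin n)))
    (p ν : EuclideanSpace ℝ (Fin n)) : Prop :=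
  ‖ν‖ = 1 ∧ ∀ y ∈ C, inner ℝ ν (y - p) ≤ 0

/-- `h` is concave and `C²` on the open ball of radius `ρ`, with `h 0 = 0`, `∇h(0) = 0`, and its
Hessian is bounded by `L` and `M`-Lipschitz on this ball. The Hessian at `z` is the bilinear form
`fderiv ℝ (fderiv ℝ h) z`; on a Euclidean space its norm is the Euclidean operator norm of the
Hessian matrix. -/
def IsC21Profile {F : Type*} [NormedAddCommGroup F] [NormedSpace ℝ F] (h : F → ℝ) (ρ L M : ℝ) :
    Prop :=
  ConcaveOn ℝ (Metric.ball 0 ρ) h ∧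
  ContDiffOn ℝ 2 h (Metric.ball 0 ρ) ∧
  h 0 = 0 ∧
  fderiv ℝ h 0 = 0 ∧
  (∀ z ∈ Metric.ball (0 : F) ρ, ‖fderiv ℝ (fderiv ℝ h) z‖ ≤ L) ∧
  (∀ z ∈ Metric.ball (0 : F) ρ, ∀ z' ∈ Metric.ball (0 : F) ρ,
    ‖fderiv ℝ (fderiv ℝ h) z - fderiv ℝ (fderiv ℝ h) z'‖ ≤ M * ‖z - z'‖)

/-- The boundary of `C` admits a local `C^{2,1}` chart at `p` with constants `(ρ, L, M)`:
in suitable Cartesian coordinates `(z, t) ∈ ℝ^{n-1} × ℝ` (given by the rigid motion `Φ`) in which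
`p` is the origin and the outward unit normal at `p` is `(0, 1)`, the part of `C` in the cylinder
`{‖z‖ < ρ, |t| < ρ}` is the part of that cylinder on or below the graph of a function `h` as in
`IsC21Profile`. -/
def HasLocalC21Chart {n : ℕ} (C : Set (EuclideanSpace ℝ (Fin n)))
    (p : EuclideanSpace ℝ (Fin n)) (ρ L M : ℝ) : Prop :=
  p ∈ frontier C ∧ 0 < ρ ∧ 0 ≤ M ∧
  ∃ (Φ : EuclideanSpace ℝ (Fin n) ≃ᵃⁱ[ℝ] WithLp 2 (EuclideanSpace ℝ (Fin (n - 1)) × ℝ))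
    (ν : EuclideanSpace ℝ (Fin n)) (h : EuclideanSpace ℝ (Fin (n - 1)) → ℝ),
    Φ p = 0 ∧
    IsOutwardUnitNormal C p ν ∧
    Φ.linearIsometryEquiv ν = WithLp.toLp 2 (0, 1) ∧
    IsC21Profile h ρ L M ∧
    (∀ z ∈ Metric.ball (0 : EuclideanSpace ℝ (Fin (n - 1))) ρ, ∀ t ∈ Ioo (-ρ) ρ,
      (Φ.symm (WithLp.toLp 2 (z, t)) ∈ C ↔ t ≤ h z))

/-- The unit vector `(x - proj_C x) / d_C(x)`. -/
noncomputable def projNormal {n : ℕ} (C : Set (EuclideanSpace ℝ (Fin n)))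
    (x : EuclideanSpace ℝ (Fin n)) : EuclideanSpace ℝ (Fin n) :=
  (Metric.infDist x C)⁻¹ • (x - metricProj C x)

/-! Put `p` at the origin, with tangential coordinate z and depth s measured along -ν. Then `C`
becomes a set S in the half-space s ≥ 0, `x` becomes (0, -d), and near 0 the set S is the epigraph s
≥ g(z) of the convex function g = -h. Up to a constant factor the Gaussian density is exp(-Q/(2δ))
with Q = ‖z‖² + 2ds + s² (`offsetSq`). The theorem is about the means of z and s under this law
restricted to S; write E for expectation.

Concentration: S is stable under halving and Q(2q) ≥ 2Q(q) on all of space, so a dilation compares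
the normalizing integrals at δ and 2δ. This gives E[Qᵏ] = O(δᵏ) without any asymptotics of the
normalizing integral. Whatever is dominated by Q² is therefore O(δ²), including everything lost by
localizing near 0 with a cutoff.

Tangential part: integrating by parts along the vertical translates of the graph of g
(`patch_moment_identity`) gives E[z] + d E[∇g(z)] + E[s∇g(z)] = O(δ²). Write ∇g(z) = Hz + R(z) with
‖R(z)‖ ≤ (M/2)‖z‖². Since H ≥ 0, testing against the mean itself bounds ‖E[z]‖ by d(M/2)E‖z‖² +
‖E[s∇g]‖ + O(δ²). A divergence identity gives E‖z‖² ≤ (n-1)δ + O(δ²). A direct estimate of E[s∇g]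
only yields O(δ^{3/2}); the same integration by parts with weight s shows E[sz] = O(δ²), hence
E[s∇g] = O(δ²). The resulting constant dM(n-1)/2 is at most the stated one.

Normal part: one integration by parts in s on each vertical fibre gives E[s - g] ≤ δ/d up to O(δ²),
and g ≤ (L/2)‖z‖² contributes L(n-1)δ/2. The error is O(δ²), better than the claimed δ^{3/2}. -/

set_option linter.unusedSectionVars false

/-! ### Gaussian laws as tilted Lebesgue measures -/

theorem integrable_exp_neg_norm_sub_sq {V : Type*} [NormedAddCommGroup V] [InnerProductSpace ℝ V]
    [FiniteDimensional ℝ V] [MeasurableSpace V] [BorelSpace V] {b : ℝ} (hb : 0 < b) (x : V) :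
    Integrable (fun y : V => Real.exp (-(b * ‖y - x‖ ^ 2))) := by
  have h := (GaussianFourier.integrable_cexp_neg_mul_sq_norm_add (V := V) (b := (b : ℂ))
    (by simpa using hb) 0 0).norm
  have h' : Integrable (fun y : V => Real.exp (-(b * ‖y‖ ^ 2))) := by
    refine h.congr (ae_of_all _ fun y => ?_)
    have : (-(b : ℂ) * (‖y‖ : ℂ) ^ 2 + 0 * ((inner ℝ (0 : V) y : ℝ) : ℂ)) =
      ((-(b * ‖y‖ ^ 2) : ℝ) : ℂ) := by push_cast; ring
    simp only [this, Complex.norm_exp_ofReal]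
  exact h'.comp_sub_right x

/-- Both sides have the same characteristic function: translating by `x` splits off a phase, and
what remains is the Fourier transform of a centred Gaussian. -/
theorem multivariateGaussian_smul_one_eq_tilted {ι : Type*} [Fintype ι] [DecidableEq ι]
    (x : EuclideanSpace ℝ ι) {δ : ℝ} (hδ : 0 < δ) :
    multivariateGaussian x (δ • (1 : Matrix ι ι ℝ)) =
      (volume : Measure (EuclideanSpace ℝ ι)).tilted (fun y => -((2 * δ)⁻¹ * ‖y - x‖ ^ 2)) := by
  have hb : 0 < (2 * δ)⁻¹ := by positivity
  have hint := integrable_exp_neg_norm_sub_sq hb x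
  have := isProbabilityMeasure_tilted hint
  refine Measure.ext_of_charFun (funext fun t => ?_)
  rw [charFun_multivariateGaussian (Matrix.PosSemidef.one.smul hδ.le), charFun_apply,
    integral_tilted]
  have hZ : (∫ y : EuclideanSpace ℝ ι, Real.exp (-((2 * δ)⁻¹ * ‖y - x‖ ^ 2))) =
      ∫ y : EuclideanSpace ℝ ι, Real.exp (-(2 * δ)⁻¹ * ‖y‖ ^ 2) := by
    rw [← integral_sub_right_eq_self (μ := volume)
      (fun y : EuclideanSpace ℝ ι => Real.exp (-(2 * δ)⁻¹ * ‖y‖ ^ 2)) x]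
    simp
  have hZ' : ((∫ y : EuclideanSpace ℝ ι, Real.exp (-((2 * δ)⁻¹ * ‖y - x‖ ^ 2)) : ℝ) : ℂ) =
      (Real.pi / ((2 * δ)⁻¹ : ℝ)) ^ (Module.finrank ℝ (EuclideanSpace ℝ ι) / 2 : ℂ) := by
    rw [hZ, GaussianFourier.integral_rexp_neg_mul_sq_norm hb,
      Complex.ofReal_cpow (by positivity)]
    push_cast; rfl
  have hne : ((∫ y : EuclideanSpace ℝ ι, Real.exp (-((2 * δ)⁻¹ * ‖y - x‖ ^ 2)) : ℝ) : ℂ) ≠ 0 := by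
    exact_mod_cast (integral_exp_pos hint).ne'
  set Z := ∫ y : EuclideanSpace ℝ ι, Real.exp (-((2 * δ)⁻¹ * ‖y - x‖ ^ 2))
  have key : ∫ y : EuclideanSpace ℝ ι, (Real.exp (-((2 * δ)⁻¹ * ‖y - x‖ ^ 2)) / Z) •
        Complex.exp ((inner ℝ y t : ℝ) * Complex.I) =
      ∫ y : EuclideanSpace ℝ ι, (Complex.exp ((inner ℝ t x : ℝ) * Complex.I) / Z) *
        Complex.exp (-(((2 * δ)⁻¹ : ℝ) : ℂ) * (‖y‖ : ℂ) ^ 2 + Complex.I * (inner ℝ t y : ℝ)) := by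
    rw [← integral_sub_right_eq_self (μ := volume) (fun y : EuclideanSpace ℝ ι =>
      (Complex.exp ((inner ℝ t x : ℝ) * Complex.I) / Z) *
        Complex.exp (-(((2 * δ)⁻¹ : ℝ) : ℂ) * (‖y‖ : ℂ) ^ 2 + Complex.I * (inner ℝ t y : ℝ))) x]
    refine integral_congr_ae (ae_of_all _ fun y => ?_)
    simp only [Complex.real_smul, Complex.ofReal_div, Complex.ofReal_exp]
    rw [div_mul_eq_mul_div, div_mul_eq_mul_div, ← Complex.exp_add, ← Complex.exp_add,
      inner_sub_right, real_inner_comm y t]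
    congr 2
    push_cast
    ring
  rw [key, integral_const_mul, GaussianFourier.integral_cexp_neg_mul_sq_norm_add
    (by simpa using hδ), ← hZ', div_mul_eq_mul_div, mul_comm (Z : ℂ), ← mul_assoc,
    mul_div_assoc, div_self hne, mul_one, ← Complex.exp_add]
  congr 1
  rw [Matrix.smul_mulVec, Matrix.one_mulVec, dotProduct_smul, smul_eq_mul]
  have : (t.ofLp ⬝ᵥ t.ofLp) = ‖t‖ ^ 2 := by
    rw [EuclideanSpace.norm_sq_eq]
    exact Finset.sum_congr rfl fun i _ => by rw [Real.norm_eq_abs, sq_abs, sq]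
  rw [this]
  have hδ' : (δ : ℂ) ≠ 0 := by exact_mod_cast hδ.ne'
  push_cast
  rw [Complex.I_sq]
  field_simp
  ring

/-- The total mass of the Gaussian weight cancels in the quotient, so conditioning amounts to
tilting Lebesgue measure on `C`. -/
theorem smoothedProj_eq_integral_tilted {n : ℕ} {C : Set (EuclideanSpace ℝ (Fin n))}
    (hC : MeasurableSet C) {δ : ℝ} (hδ : 0 < δ) (x : EuclideanSpace ℝ (Fin n)) :
    smoothedProj C δ x =
      ∫ y, y ∂((volume.restrict C).tilted (fun y => -((2 * δ)⁻¹ * ‖y - x‖ ^ 2))) := by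
  have hb : 0 < (2 * δ)⁻¹ := by positivity
  have hpos := integral_exp_pos (integrable_exp_neg_norm_sub_sq hb x)
  rw [smoothedProj, multivariateGaussian_smul_one_eq_tilted x hδ, integral_indicator hC,
    integral_indicator hC, setIntegral_tilted' _ _ hC, setIntegral_tilted' _ _ hC,
    integral_tilted]
  set Z := ∫ y : EuclideanSpace ℝ (Fin n), Real.exp (-((2 * δ)⁻¹ * ‖y - x‖ ^ 2))
  simp only [smul_eq_mul, mul_one, div_eq_inv_mul, mul_smul]
  rw [integral_const_mul, integral_smul, integral_smul, mul_inv, inv_inv, smul_smul]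
  congr 1
  field_simp

/-! ### Concentration of the conditioned Gaussian -/

section Gibbs

variable {V : Type*} [NormedAddCommGroup V]

/-- The squared distance from `(z, s)` to `(0, -d)`, minus `d ^ 2`. -/
def offsetSq (d : ℝ) (q : V × ℝ) : ℝ := ‖q.1‖ ^ 2 + 2 * d * q.2 + q.2 ^ 2

theorem continuous_offsetSq (d : ℝ) : Continuous (offsetSq d : V × ℝ → ℝ) := by
  unfold offsetSq; fun_prop

theorem offsetSq_nonneg {d : ℝ} (hd : 0 ≤ d) {q : V × ℝ} (hq : 0 ≤ q.2) : 0 ≤ offsetSq d q := by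
  unfold offsetSq; positivity

theorem norm_fst_sq_le_offsetSq {d : ℝ} (hd : 0 ≤ d) {q : V × ℝ} (hq : 0 ≤ q.2) :
    ‖q.1‖ ^ 2 ≤ offsetSq d q := by
  unfold offsetSq; nlinarith [mul_nonneg hd hq, sq_nonneg q.2]

theorem snd_le_offsetSq {d : ℝ} {q : V × ℝ} : 2 * d * q.2 ≤ offsetSq d q := by
  unfold offsetSq; nlinarith [sq_nonneg ‖q.1‖, sq_nonneg q.2]

variable [InnerProductSpace ℝ V] [FiniteDimensional ℝ V] [MeasurableSpace V] [BorelSpace V]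

theorem integrable_exp_neg_offsetSq (d : ℝ) {b : ℝ} (hb : 0 < b) :
    Integrable (fun q : V × ℝ => Real.exp (-(b * offsetSq d q))) := by
  have h1 := integrable_exp_neg_norm_sub_sq hb (0 : V)
  have h2 := integrable_exp_neg_norm_sub_sq hb (-d : ℝ)
  refine ((h1.mul_prod h2).const_mul (Real.exp (b * d ^ 2))).congr (ae_of_all _ fun q => ?_)
  simp only [← Real.exp_add, offsetSq, Real.norm_eq_abs, sq_abs]
  congr 1
  simp
  ring

/-- The normal law centred at `(0, -d)` with covariance `δ I`, conditioned on `S`. -/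
noncomputable def condGauss (S : Set (V × ℝ)) (d δ : ℝ) : Measure (V × ℝ) :=
  (volume.restrict S).tilted (fun q => -((2 * δ)⁻¹ * offsetSq d q))

theorem integral_condGauss {E : Type*} [NormedAddCommGroup E] [NormedSpace ℝ E]
    (S : Set (V × ℝ)) (d δ : ℝ) (f : V × ℝ → E) :
    ∫ q, f q ∂(condGauss S d δ) =
      (∫ q in S, Real.exp (-((2 * δ)⁻¹ * offsetSq d q)))⁻¹ •
        ∫ q in S, Real.exp (-((2 * δ)⁻¹ * offsetSq d q)) • f q := by
  rw [condGauss, integral_tilted, ← integral_smul]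
  simp only [div_eq_inv_mul, mul_smul]

theorem ae_condGauss_mem {S : Set (V × ℝ)} (hS : MeasurableSet S) (d δ : ℝ) :
    ∀ᵐ q ∂(condGauss S d δ), q ∈ S :=
  (tilted_absolutelyContinuous _ _).ae_le (ae_restrict_mem hS)

theorem isProbabilityMeasure_condGauss {S : Set (V × ℝ)} (hS : volume S ≠ 0) (d : ℝ) {δ : ℝ}
    (hδ : 0 < δ) : IsProbabilityMeasure (condGauss S d δ) := by
  have : NeZero ((volume : Measure (V × ℝ)).restrict S) := ⟨by simpa using hS⟩
  exact isProbabilityMeasure_tilted (integrable_exp_neg_offsetSq d (by positivity)).restrict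

/-- If `S` is star-shaped at the origin, the exponential moment of `offsetSq` of order `1 / (4 δ)`
is bounded independently of `δ`. -/
theorem integrable_exp_and_integral_exp_le {S : Set (V × ℝ)} (hSm : MeasurableSet S)
    (hS : volume S ≠ 0) (hstar : ∀ q, (2 : ℝ) • q ∈ S → q ∈ S) {d δ : ℝ} (hδ : 0 < δ) :
    Integrable (fun q => Real.exp ((4 * δ)⁻¹ * offsetSq d q)) (condGauss S d δ) ∧
    ∫ q, Real.exp ((4 * δ)⁻¹ * offsetSq d q) ∂(condGauss S d δ) ≤
      2 ^ (Module.finrank ℝ V + 1) := by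
  have : NeZero ((volume : Measure (V × ℝ)).restrict S) := ⟨by simpa using hS⟩
  have h4 : Integrable (fun q : V × ℝ => Real.exp (-((4 * δ)⁻¹ * offsetSq d q))) :=
    integrable_exp_neg_offsetSq d (by positivity)
  have h2 : Integrable (fun q : V × ℝ => Real.exp (-((2 * δ)⁻¹ * offsetSq d q))) :=
    integrable_exp_neg_offsetSq d (by positivity)
  have hmul : ∀ q : V × ℝ, Real.exp (-((2 * δ)⁻¹ * offsetSq d q)) *
      Real.exp ((4 * δ)⁻¹ * offsetSq d q) = Real.exp (-((4 * δ)⁻¹ * offsetSq d q)) := by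
    intro q
    rw [← Real.exp_add]
    congr 1
    field_simp
    ring
  constructor
  · rw [condGauss, integrable_tilted_iff h2.restrict]
    simp only [smul_eq_mul, hmul]
    exact h4.restrict
  rw [integral_condGauss]
  simp only [smul_eq_mul, hmul]
  have hZ : 0 < ∫ q in S, Real.exp (-((2 * δ)⁻¹ * offsetSq d q)) :=
    integral_exp_pos h2.restrict
  rw [inv_mul_le_iff₀ hZ]
  have : (volume : Measure (V × ℝ)).IsAddHaarMeasure :=
    inferInstanceAs ((volume : Measure V).prod (volume : Measure ℝ)).IsAddHaarMeasure
  have hscale := Measure.integral_comp_smul (volume : Measure (V × ℝ))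
    (S.indicator fun q => Real.exp (-((4 * δ)⁻¹ * offsetSq d q))) 2
  rw [integral_indicator hSm, Module.finrank_prod, Module.finrank_self, smul_eq_mul] at hscale
  -- After the substitution q ↦ 2q, star-shapedness handles the indicator. The terms ‖z‖² and s²
  -- gain a factor 4 and 2ds gains 2, so the exponent at 4δ dominates the one at 2δ. The Jacobian is
  -- the power of 2 in the bound.
  have hle : ∫ q : V × ℝ, S.indicator (fun q => Real.exp (-((4 * δ)⁻¹ * offsetSq d q)))
      ((2 : ℝ) • q) ≤ ∫ q in S, Real.exp (-((2 * δ)⁻¹ * offsetSq d q)) := by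
    rw [← integral_indicator hSm]
    refine integral_mono_of_nonneg (ae_of_all _ fun q => indicator_nonneg
      (fun _ _ => (Real.exp_pos _).le) _) (h2.indicator hSm) (ae_of_all _ fun q => ?_)
    by_cases h : (2 : ℝ) • q ∈ S
    · simp only [indicator_of_mem h, indicator_of_mem (hstar q h)]
      refine Real.exp_le_exp.2 (neg_le_neg ?_)
      have : 2 * offsetSq d q ≤ offsetSq d ((2 : ℝ) • q) := by
        simp only [offsetSq, Prod.smul_fst, Prod.smul_snd, norm_smul, smul_eq_mul,
          Real.norm_ofNat]
        nlinarith [sq_nonneg ‖q.1‖, sq_nonneg q.2]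
      calc (2 * δ)⁻¹ * offsetSq d q = (4 * δ)⁻¹ * (2 * offsetSq d q) := by field_simp; ring
        _ ≤ _ := by gcongr
    · simp only [indicator_of_notMem h]
      exact indicator_nonneg (fun _ _ => (Real.exp_pos _).le) _
  rw [hscale, abs_of_pos (by positivity), inv_mul_le_iff₀ (by positivity)] at hle
  linarith

/-- Apply tᵏ/k! ≤ eᵗ with t = Q/(4δ), which is nonnegative on S because S lies in the upper
half-space. -/
theorem integrable_offsetSq_pow_and_integral_le {S : Set (V × ℝ)} (hSm : MeasurableSet S)
    (hS : volume S ≠ 0) (hstar : ∀ q, (2 : ℝ) • q ∈ S → q ∈ S) (hpos : ∀ q ∈ S, 0 ≤ q.2)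
    {d δ : ℝ} (hd : 0 ≤ d) (hδ : 0 < δ) (k : ℕ) :
    Integrable (fun q => offsetSq d q ^ k) (condGauss S d δ) ∧
    ∫ q, offsetSq d q ^ k ∂(condGauss S d δ) ≤
      (2 ^ (Module.finrank ℝ V + 1) * (k.factorial * 4 ^ k)) * δ ^ k := by
  obtain ⟨h1, h2⟩ := integrable_exp_and_integral_exp_le hSm hS hstar (d := d) hδ
  have hb : ∀ᵐ q ∂(condGauss S d δ), offsetSq d q ^ k ≤
      (k.factorial * (4 * δ) ^ k) * Real.exp ((4 * δ)⁻¹ * offsetSq d q) := by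
    filter_upwards [ae_condGauss_mem hSm d δ] with q hq
    have h0 := offsetSq_nonneg hd (hpos q hq)
    have := Real.pow_div_factorial_le_exp ((4 * δ)⁻¹ * offsetSq d q) (by positivity) k
    rw [div_le_iff₀ (by positivity), mul_pow, inv_pow, inv_mul_le_iff₀ (by positivity)] at this
    linarith
  have hn : ∀ᵐ q ∂(condGauss S d δ), 0 ≤ offsetSq d q ^ k := by
    filter_upwards [ae_condGauss_mem hSm d δ] with q hq
    exact pow_nonneg (offsetSq_nonneg hd (hpos q hq)) k
  have hi : Integrable (fun q => offsetSq d q ^ k) (condGauss S d δ) := by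
    refine (h1.const_mul (k.factorial * (4 * δ) ^ k)).mono'
      ((continuous_offsetSq d).pow k).aestronglyMeasurable ?_
    filter_upwards [hb, hn] with q hq hq'
    rwa [Real.norm_of_nonneg hq']
  refine ⟨hi, (integral_mono_ae hi (h1.const_mul _) hb).trans ?_⟩
  rw [integral_const_mul]
  calc _ ≤ (k.factorial * (4 * δ) ^ k) * 2 ^ (Module.finrank ℝ V + 1) := by gcongr
    _ = _ := by rw [mul_pow]; ring

end Gibbs

/-! ### Integration by parts on graph layers and on vertical fibres -/

section LocalEpigraph

variable {V : Type*} [NormedAddCommGroup V] [InnerProductSpace ℝ V]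

/-- Near the origin, the set `S` of the upper half-space is the epigraph of a nonnegative function
`g` with gradient `G`, which is approximated to second order at `0` by the quadratic form `H`. -/
structure IsLocalEpigraph (S : Set (V × ℝ)) (g : V → ℝ) (G : V → V →L[ℝ] ℝ)
    (H : V →L[ℝ] V →L[ℝ] ℝ) (ρ L M : ℝ) : Prop where
  radius_pos : 0 < ρ
  L_nonneg : 0 ≤ L
  M_nonneg : 0 ≤ M
  snd_nonneg : ∀ q ∈ S, 0 ≤ q.2
  star : ∀ q, (2 : ℝ) • q ∈ S → q ∈ S
  mem_iff : ∀ z ∈ Metric.ball (0 : V) ρ, ∀ t ∈ Ioo (-ρ) ρ, ((z, t) ∈ S ↔ g z ≤ t)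
  hasFDerivAt : ∀ z ∈ Metric.ball (0 : V) ρ, HasFDerivAt g (G z) z
  continuousOn : ContinuousOn G (Metric.ball 0 ρ)
  nonneg : ∀ z ∈ Metric.ball (0 : V) ρ, 0 ≤ g z
  le_sq : ∀ z ∈ Metric.ball (0 : V) ρ, g z ≤ L / 2 * ‖z‖ ^ 2
  norm_grad_le : ∀ z ∈ Metric.ball (0 : V) ρ, ‖G z‖ ≤ L * ‖z‖
  norm_grad_sub_le : ∀ z ∈ Metric.ball (0 : V) ρ, ‖G z - H z‖ ≤ M / 2 * ‖z‖ ^ 2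
  radial_nonneg : ∀ z ∈ Metric.ball (0 : V) ρ, 0 ≤ G z z
  quadratic_nonneg : ∀ a, 0 ≤ H a a

/-- The part of the epigraph of `g` over the ball of radius `r` up to height `η`. -/
def epigraphPatch (g : V → ℝ) (r η : ℝ) : Set (V × ℝ) :=
  {q | q.1 ∈ Metric.closedBall 0 r ∧ q.2 - g q.1 ∈ Ico 0 η}

theorem hasFDerivAt_offsetSq_graph {g : V → ℝ} {G : V →L[ℝ] ℝ} {z : V} (hg : HasFDerivAt g G z)
    (d σ : ℝ) : HasFDerivAt (fun z => offsetSq d (z, g z + σ))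
      ((2 : ℝ) • innerSL ℝ z + (2 * (d + (g z + σ))) • G) z := by
  have h1 : HasFDerivAt (fun z : V => ‖z‖ ^ 2) ((2 : ℝ) • innerSL ℝ z) z := by
    convert! (hasStrictFDerivAt_norm_sq z).hasFDerivAt using 1
    ext; simp
  have h2 := hg.add_const σ
  have h3 := (h1.add (h2.const_mul (2 * d))).add (h2.pow 2)
  convert! h3 using 1
  ext u
  simp
  ring

theorem hasFDerivAt_graph {g : V → ℝ} {G : V →L[ℝ] ℝ} {z : V} (hg : HasFDerivAt g G z) (σ : ℝ) :
    HasFDerivAt (fun z => (z, g z + σ)) ((ContinuousLinearMap.id ℝ V).prod G) z :=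
  (hasFDerivAt_id z).prodMk (hg.add_const σ)

theorem hasFDerivAt_affine_mul_exp {g : V → ℝ} {G : V →L[ℝ] ℝ} {z : V} (hg : HasFDerivAt g G z)
    (d b σ c : ℝ) (l : V × ℝ →L[ℝ] ℝ) :
    HasFDerivAt (fun z => (c + l (z, g z + σ)) * Real.exp (-(b * offsetSq d (z, g z + σ))))
      (Real.exp (-(b * offsetSq d (z, g z + σ))) • (l.comp ((ContinuousLinearMap.id ℝ V).prod G) -
        (b * (c + l (z, g z + σ))) • ((2 : ℝ) • innerSL ℝ z + (2 * (d + (g z + σ))) • G))) z := by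
  have h1 := ((l.hasFDerivAt (x := (z, g z + σ))).comp z (hasFDerivAt_graph hg σ)).const_add c
  have h2 := ((hasFDerivAt_offsetSq_graph hg d σ).const_mul b).neg.exp
  convert! h1.mul h2 using 1
  ext u
  simp
  ring

/-- This is the vanishing of ∫ ∂ᵤ(χF), where F is the affine weight times exp(-bQ) on the layer at
height g + σ. F is only known to be differentiable on the ball of radius `ρ`, which contains the
support of `χ`. -/
theorem integral_mul_deriv_affine_mul_exp [FiniteDimensional ℝ V] [MeasurableSpace V]
    [BorelSpace V] {g : V → ℝ} {G : V → V →L[ℝ] ℝ} {ρ r : ℝ} (hr : r < ρ)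
    (hg : ∀ z ∈ Metric.ball (0 : V) ρ, HasFDerivAt g (G z) z)
    (hG : ContinuousOn G (Metric.ball 0 ρ)) {χ : V → ℝ} {χ' : V → V →L[ℝ] ℝ}
    (hχ : ∀ z, HasFDerivAt χ (χ' z) z) (hχ' : Continuous χ')
    (hsupp : tsupport χ ⊆ Metric.closedBall 0 r) (d b σ c : ℝ) (l : V × ℝ →L[ℝ] ℝ) (u : V) :
    ∫ z in Metric.closedBall 0 r, Real.exp (-(b * offsetSq d (z, g z + σ))) *
      (χ z * (l (u, G z u) - 2 * b * (c + l (z, g z + σ)) *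
        (inner ℝ z u + (d + (g z + σ)) * G z u)) + χ' z u * (c + l (z, g z + σ))) = 0 := by
  have hball : Metric.closedBall (0 : V) r ⊆ Metric.ball 0 ρ :=
    Metric.closedBall_subset_ball hr
  have hgc : ContinuousOn g (Metric.closedBall 0 r) := fun z hz =>
    (hg z (hball hz)).continuousAt.continuousWithinAt
  have hGc := hG.mono hball
  have hχc : Continuous χ := continuous_iff_continuousAt.2 fun z => (hχ z).continuousAt
  have hχ0 : ∀ z ∉ Metric.closedBall (0 : V) r, χ z = 0 := fun z hz =>
    image_eq_zero_of_notMem_tsupport fun h => hz (hsupp h)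
  have hχ'0 : ∀ z ∉ Metric.closedBall (0 : V) r, χ' z = 0 := by
    intro z hz
    have : χ =ᶠ[nhds z] fun _ => 0 := notMem_tsupport_iff_eventuallyEq.1 fun h => hz (hsupp h)
    exact (hχ z).unique ((hasFDerivAt_const (0 : ℝ) z).congr_of_eventuallyEq this)
  have key : ∀ f : V → ℝ, ContinuousOn f (Metric.closedBall 0 r) →
      (∀ z ∉ Metric.closedBall (0 : V) r, f z = 0) → Integrable f := fun f hf h0 =>
    (integrableOn_iff_integrable_of_support_subset
      (Function.support_subset_iff'.2 h0)).1
      (hf.integrableOn_compact (isCompact_closedBall 0 r))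
  set F : V → ℝ := fun z => (c + l (z, g z + σ)) * Real.exp (-(b * offsetSq d (z, g z + σ)))
  set F' : V → V →L[ℝ] ℝ := fun z =>
    Real.exp (-(b * offsetSq d (z, g z + σ))) • (l.comp ((ContinuousLinearMap.id ℝ V).prod (G z)) -
        (b * (c + l (z, g z + σ))) • ((2 : ℝ) • innerSL ℝ z + (2 * (d + (g z + σ))) • G z))
  have hF : ∀ z ∈ Metric.ball (0 : V) ρ, HasFDerivAt F (F' z) z := fun z hz =>
    hasFDerivAt_affine_mul_exp (hg z hz) d b σ c l
  have hF'u : ∀ z, F' z u = Real.exp (-(b * offsetSq d (z, g z + σ))) *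
      (l (u, G z u) - 2 * b * (c + l (z, g z + σ)) *
        (inner ℝ z u + (d + (g z + σ)) * G z u)) := by
    intro z
    simp [F']
    ring
  have hoff : ContinuousOn (fun z => offsetSq d (z, g z + σ)) (Metric.closedBall (0 : V) r) :=
    (continuous_offsetSq d).comp_continuousOn (by fun_prop)
  have hl1 : ContinuousOn (fun z => l (z, g z + σ)) (Metric.closedBall (0 : V) r) :=
    l.continuous.comp_continuousOn (by fun_prop)
  have hGu : ContinuousOn (fun z => G z u) (Metric.closedBall (0 : V) r) :=
    hGc.clm_apply continuousOn_const
  have hl2 : ContinuousOn (fun z => l (u, G z u)) (Metric.closedBall (0 : V) r) :=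
    l.continuous.comp_continuousOn (by fun_prop)
  have hFc : ContinuousOn F (Metric.closedBall 0 r) := by fun_prop
  have hF'c : ContinuousOn (fun z => F' z u) (Metric.closedBall 0 r) := by
    simp only [hF'u]; fun_prop
  have hχ'u : Continuous fun z => χ' z u := hχ'.clm_apply continuous_const
  have i1 : Integrable fun z => χ' z u * F z :=
    key _ (hχ'u.continuousOn.mul hFc) fun z hz => by simp [hχ'0 z hz]
  have i2 : Integrable fun z => χ z * F' z u :=
    key _ (hχc.continuousOn.mul hF'c) fun z hz => by simp [hχ0 z hz]
  have i3 : Integrable fun z => χ z * F z :=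
    key _ (hχc.continuousOn.mul hFc) fun z hz => by simp [hχ0 z hz]
  have ibp := integral_bilinear_hasFDerivAt_right_eq_neg_left_of_integrable (μ := volume)
    (f := χ) (f' := χ') (g := F) (g' := F') (v := u) (B := ContinuousLinearMap.mul ℝ ℝ)
    i1 i2 i3 (fun z _ => hχ z) (fun z hz => hF z (hball (hsupp hz)))
  simp only [ContinuousLinearMap.mul_apply'] at ibp
  rw [setIntegral_eq_integral_of_forall_compl_eq_zero
    (fun z hz => by simp [hχ0 z hz, hχ'0 z hz])]
  have : ∫ z, (χ z * F' z u + χ' z u * F z) = 0 := by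
    rw [integral_add i2 i1, ibp]; ring
  rw [← this]
  refine integral_congr_ae (ae_of_all _ fun z => ?_)
  simp only [hF'u, F]
  ring

/-- The function -δσ exp(-Q/(2δ)) vanishes at σ = 0, is negative at σ = η, and has derivative (σ(d +
γ + σ) - δ) exp(-Q/(2δ)). Since γ and σ are nonnegative, this derivative dominates the integrand. -/
theorem integral_sub_mul_exp_nonpos {d δ η : ℝ} (hδ : 0 < δ) (hη : 0 < η) (z : V)
    {γ : ℝ} (hγ : 0 ≤ γ) :
    ∫ σ in Ico 0 η, (d * σ - δ) * Real.exp (-((2 * δ)⁻¹ * offsetSq d (z, γ + σ))) ≤ 0 := by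
  have hderiv : ∀ σ : ℝ, HasDerivAt
      (fun σ => -δ * (σ * Real.exp (-((2 * δ)⁻¹ * offsetSq d (z, γ + σ)))))
      ((σ * (d + (γ + σ)) - δ) * Real.exp (-((2 * δ)⁻¹ * offsetSq d (z, γ + σ)))) σ := by
    intro σ
    have h1 : HasDerivAt (fun σ => γ + σ) 1 σ := (hasDerivAt_id σ).const_add γ
    have h2 : HasDerivAt (fun σ => offsetSq d (z, γ + σ)) (2 * (d + (γ + σ))) σ := by
      convert! ((h1.const_mul (2 * d)).const_add (‖z‖ ^ 2)).add (h1.pow 2) using 1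
      simp
      ring
    convert! ((hasDerivAt_id σ).mul (h2.const_mul (2 * δ)⁻¹).neg.exp).const_mul (-δ) using 1
    simp
    field_simp
    ring
  have hoff : Continuous fun σ : ℝ => offsetSq d (z, γ + σ) :=
    (continuous_offsetSq d).comp (by fun_prop)
  have hint := intervalIntegral.integral_eq_sub_of_hasDerivAt (a := 0) (b := η)
    (fun σ _ => hderiv σ) ((by fun_prop : Continuous fun σ : ℝ => (σ * (d + (γ + σ)) - δ) *
      Real.exp (-((2 * δ)⁻¹ * offsetSq d (z, γ + σ)))).intervalIntegrable 0 η)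
  rw [integral_Ico_eq_integral_Ioc, ← intervalIntegral.integral_of_le hη.le]
  calc _ ≤ ∫ σ in (0 : ℝ)..η, (σ * (d + (γ + σ)) - δ) *
          Real.exp (-((2 * δ)⁻¹ * offsetSq d (z, γ + σ))) := by
        refine intervalIntegral.integral_mono_on hη.le
          ((by fun_prop : Continuous _).intervalIntegrable 0 η)
          ((by fun_prop : Continuous _).intervalIntegrable 0 η) fun σ hσ => ?_
        refine mul_le_mul_of_nonneg_right ?_ (Real.exp_pos _).le
        nlinarith [mul_nonneg hσ.1 hγ, mul_nonneg hσ.1 hσ.1]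
    _ ≤ 0 := by
        rw [hint]
        have := mul_pos hδ (mul_pos hη (Real.exp_pos
          (-((2 * δ)⁻¹ * offsetSq d (z, γ + η)))))
        rw [zero_mul]
        linarith

end LocalEpigraph

/-! ### Straightening the patch by a shear -/

section EpigraphPatch

variable {V : Type*} [NormedAddCommGroup V] [InnerProductSpace ℝ V] [FiniteDimensional ℝ V]
  [MeasurableSpace V] [BorelSpace V]

/-- The shear `(z, s) ↦ (z, f z + s)`. -/
def shearEquiv (f : V → ℝ) (hf : Measurable f) : V × ℝ ≃ᵐ V × ℝ where
  toFun q := (q.1, f q.1 + q.2)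
  invFun q := (q.1, q.2 - f q.1)
  left_inv q := by simp
  right_inv q := by simp
  measurable_toFun := by simp only [Equiv.coe_fn_mk]; fun_prop
  measurable_invFun := by simp only [Equiv.coe_fn_symm_mk]; fun_prop

theorem measurePreserving_shearEquiv (f : V → ℝ) (hf : Measurable f) :
    MeasurePreserving (shearEquiv f hf) :=
  (MeasurePreserving.id (volume : Measure V)).skew_product (g := fun z s => f z + s)
    (by unfold Function.uncurry; fun_prop)
    (ae_of_all _ fun z => (measurePreserving_add_left volume (f z)).map_eq)

/-- The shear needs a globally measurable function, whereas `g` is controlled only on the ball. -/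
theorem exists_measurable_eqOn_closedBall {g : V → ℝ} {r : ℝ}
    (hg : ContinuousOn g (Metric.closedBall 0 r)) :
    ∃ f : V → ℝ, Measurable f ∧ ∀ z ∈ Metric.closedBall (0 : V) r, f z = g z := by
  classical
  exact ⟨(Metric.closedBall (0 : V) r).piecewise g 0,
    hg.measurable_piecewise continuousOn_const Metric.isClosed_closedBall.measurableSet,
    fun z hz => piecewise_eq_of_mem _ _ _ hz⟩

theorem epigraphPatch_eq_preimage {g f : V → ℝ} {r : ℝ} (η : ℝ) (hf : Measurable f)
    (hfg : ∀ z ∈ Metric.closedBall (0 : V) r, f z = g z) :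
    epigraphPatch g r η = (shearEquiv f hf).symm ⁻¹' (Metric.closedBall 0 r ×ˢ Ico 0 η) := by
  ext q
  change (_ ∧ _) ↔ q.1 ∈ Metric.closedBall (0 : V) r ∧ q.2 - f q.1 ∈ Ico 0 η
  refine and_congr_right fun hq => ?_
  rw [hfg _ hq]

theorem measurableSet_epigraphPatch {g : V → ℝ} {r : ℝ} (η : ℝ)
    (hg : ContinuousOn g (Metric.closedBall 0 r)) : MeasurableSet (epigraphPatch g r η) := by
  obtain ⟨f, hf, hfg⟩ := exists_measurable_eqOn_closedBall hg
  rw [epigraphPatch_eq_preimage η hf hfg]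
  exact (shearEquiv f hf).symm.measurable
    (Metric.isClosed_closedBall.measurableSet.prod measurableSet_Ico)

theorem setIntegral_epigraphPatch {g : V → ℝ} {r : ℝ} (η : ℝ)
    (hg : ContinuousOn g (Metric.closedBall 0 r)) (Ψ : V × ℝ → ℝ) :
    ∫ q in epigraphPatch g r η, Ψ q =
      ∫ p in Metric.closedBall (0 : V) r ×ˢ Ico 0 η, Ψ (p.1, g p.1 + p.2) := by
  obtain ⟨f, hf, hfg⟩ := exists_measurable_eqOn_closedBall hg
  rw [epigraphPatch_eq_preimage η hf hfg,
    ← (measurePreserving_shearEquiv f hf).setIntegral_preimage_emb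
      (shearEquiv f hf).measurableEmbedding, ← preimage_comp]
  simp only [MeasurableEquiv.symm_comp_self, preimage_id]
  refine setIntegral_congr_fun (Metric.isClosed_closedBall.measurableSet.prod measurableSet_Ico)
    fun p hp => ?_
  change Ψ (p.1, f p.1 + p.2) = _
  rw [hfg _ hp.1]

theorem integrableOn_prod_of_continuousOn {r η : ℝ} {Ψ : V × ℝ → ℝ}
    (h : ContinuousOn Ψ (Metric.closedBall 0 r ×ˢ univ)) :
    IntegrableOn Ψ (Metric.closedBall 0 r ×ˢ Ico 0 η) ((volume : Measure V).prod volume) :=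
  ((h.mono (prod_mono_right (subset_univ _))).integrableOn_compact
    ((isCompact_closedBall 0 r).prod isCompact_Icc)).mono_set (prod_mono_right Ico_subset_Icc_self)

theorem setIntegral_condGauss {S D : Set (V × ℝ)} (hD : MeasurableSet D) (hDS : D ⊆ S)
    (d δ : ℝ) (f : V × ℝ → ℝ) :
    ∫ q in D, f q ∂(condGauss S d δ) =
      (∫ q in S, Real.exp (-((2 * δ)⁻¹ * offsetSq d q)))⁻¹ *
        ∫ q in D, Real.exp (-((2 * δ)⁻¹ * offsetSq d q)) * f q := by
  rw [condGauss, setIntegral_tilted' _ _ hD, Measure.restrict_restrict hD,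
    inter_eq_self_of_subset_left hDS, ← integral_const_mul]
  simp only [div_eq_inv_mul, smul_eq_mul, mul_assoc]

variable {S : Set (V × ℝ)} {g : V → ℝ} {G : V → V →L[ℝ] ℝ} {H : V →L[ℝ] V →L[ℝ] ℝ} {ρ L M : ℝ}

theorem IsLocalEpigraph.continuousOn_closedBall (h : IsLocalEpigraph S g G H ρ L M) {r : ℝ}
    (hr : r < ρ) : ContinuousOn g (Metric.closedBall 0 r) := fun z hz =>
  (h.hasFDerivAt z (Metric.closedBall_subset_ball hr hz)).continuousAt.continuousWithinAt

/-- The shear turns the patch into a cylinder whose slices are graph layers, and the integral over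
each layer vanishes. Differentiation is along the layers only, and the cutoff depends on z alone, so
the top and bottom of the patch contribute no boundary term. -/
theorem integral_condGauss_patch_deriv (h : IsLocalEpigraph S g G H ρ L M) {r η : ℝ} (hr : r < ρ)
    (hsub : epigraphPatch g r η ⊆ S) {χ : V → ℝ} {χ' : V → V →L[ℝ] ℝ}
    (hχ : ∀ z, HasFDerivAt χ (χ' z) z) (hχ' : Continuous χ')
    (hsupp : tsupport χ ⊆ Metric.closedBall 0 r) (d : ℝ) {δ : ℝ} (hδ : 0 < δ) (c : ℝ)
    (l : V × ℝ →L[ℝ] ℝ) (u : V) :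
    ∫ q in epigraphPatch g r η, (χ q.1 * (δ * l (u, G q.1 u) - (c + l q) *
        (inner ℝ q.1 u + (d + q.2) * G q.1 u)) + δ * χ' q.1 u * (c + l q))
      ∂(condGauss S d δ) = 0 := by
  have hgc := h.continuousOn_closedBall hr
  have hGc := h.continuousOn.mono (Metric.closedBall_subset_ball hr)
  have hχc : Continuous χ := continuous_iff_continuousAt.2 fun z => (hχ z).continuousAt
  rw [setIntegral_condGauss (measurableSet_epigraphPatch η hgc) hsub,
    setIntegral_epigraphPatch η hgc, Measure.volume_eq_prod]
  refine mul_eq_zero_of_right _ ?_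
  have hfst : ContinuousOn (Prod.fst : V × ℝ → V) (Metric.closedBall (0 : V) r ×ˢ univ) :=
    continuousOn_fst
  have hmaps : MapsTo (Prod.fst : V × ℝ → V) (Metric.closedBall (0 : V) r ×ˢ univ)
    (Metric.closedBall (0 : V) r) := fun p hp => hp.1
  have c1 : ContinuousOn (fun p : V × ℝ => g p.1) (Metric.closedBall (0 : V) r ×ˢ univ) :=
    hgc.comp hfst hmaps
  have c2 : ContinuousOn (fun p : V × ℝ => G p.1 u) (Metric.closedBall (0 : V) r ×ˢ univ) :=
    (hGc.comp hfst hmaps).clm_apply continuousOn_const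
  have c3 : Continuous fun z => χ' z u := hχ'.clm_apply continuous_const
  have c4 : ContinuousOn (fun p : V × ℝ => offsetSq d (p.1, g p.1 + p.2))
      (Metric.closedBall (0 : V) r ×ˢ univ) :=
    (continuous_offsetSq d).comp_continuousOn (by fun_prop)
  have c5 : ContinuousOn (fun p : V × ℝ => l (p.1, g p.1 + p.2))
      (Metric.closedBall (0 : V) r ×ˢ univ) := l.continuous.comp_continuousOn (by fun_prop)
  have c6 : ContinuousOn (fun p : V × ℝ => l (u, G p.1 u))
      (Metric.closedBall (0 : V) r ×ˢ univ) := l.continuous.comp_continuousOn (by fun_prop)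
  have c7 : ContinuousOn (fun p : V × ℝ => χ p.1) (Metric.closedBall (0 : V) r ×ˢ univ) :=
    hχc.comp_continuousOn hfst
  have c8 : ContinuousOn (fun p : V × ℝ => χ' p.1 u) (Metric.closedBall (0 : V) r ×ˢ univ) :=
    c3.comp_continuousOn hfst
  rw [← Measure.prod_restrict, integral_prod_symm]
  · refine (integral_congr_ae (ae_of_all _ fun σ => ?_)).trans (integral_zero _ _)
    have key := integral_mul_deriv_affine_mul_exp hr h.hasFDerivAt h.continuousOn hχ hχ' hsupp d
      (2 * δ)⁻¹ σ c l u
    rw [← mul_zero δ, ← key, ← integral_const_mul]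
    refine integral_congr_ae (ae_of_all _ fun z => ?_)
    field_simp
  · rw [Measure.prod_restrict]
    exact integrableOn_prod_of_continuousOn (by fun_prop)

theorem integral_condGauss_patch_height (h : IsLocalEpigraph S g G H ρ L M) {r η : ℝ} (hr : r < ρ)
    (hη : 0 < η) (hsub : epigraphPatch g r η ⊆ S) {χ : V → ℝ} (hχc : Continuous χ)
    (hχ : ∀ z, 0 ≤ χ z) (d : ℝ) {δ : ℝ} (hδ : 0 < δ) :
    ∫ q in epigraphPatch g r η, χ q.1 * (d * (q.2 - g q.1) - δ) ∂(condGauss S d δ) ≤ 0 := by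
  have hgc := h.continuousOn_closedBall hr
  rw [setIntegral_condGauss (measurableSet_epigraphPatch η hgc) hsub,
    setIntegral_epigraphPatch η hgc, Measure.volume_eq_prod]
  refine mul_nonpos_of_nonneg_of_nonpos
    (inv_nonneg.2 (integral_nonneg fun _ => (Real.exp_pos _).le)) ?_
  have hfst : ContinuousOn (Prod.fst : V × ℝ → V) (Metric.closedBall (0 : V) r ×ˢ univ) :=
    continuousOn_fst
  have hmaps : MapsTo (Prod.fst : V × ℝ → V) (Metric.closedBall (0 : V) r ×ˢ univ)
    (Metric.closedBall (0 : V) r) := fun p hp => hp.1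
  have c1 : ContinuousOn (fun p : V × ℝ => g p.1) (Metric.closedBall (0 : V) r ×ˢ univ) :=
    hgc.comp hfst hmaps
  have c4 : ContinuousOn (fun p : V × ℝ => offsetSq d (p.1, g p.1 + p.2))
      (Metric.closedBall (0 : V) r ×ˢ univ) :=
    (continuous_offsetSq d).comp_continuousOn (by fun_prop)
  have c7 : ContinuousOn (fun p : V × ℝ => χ p.1) (Metric.closedBall (0 : V) r ×ˢ univ) :=
    hχc.comp_continuousOn hfst
  rw [setIntegral_prod _ (integrableOn_prod_of_continuousOn (by fun_prop))]
  refine setIntegral_nonpos Metric.isClosed_closedBall.measurableSet fun z hz => ?_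
  have key := integral_sub_mul_exp_nonpos (d := d) hδ hη z
    (h.nonneg z (Metric.closedBall_subset_ball hr hz))
  calc _ = χ z * ∫ σ in Ico 0 η, (d * σ - δ) *
        Real.exp (-((2 * δ)⁻¹ * offsetSq d (z, g z + σ))) := by
        rw [← integral_const_mul]
        refine integral_congr_ae (ae_of_all _ fun σ => ?_)
        simp only [add_sub_cancel_left]
        ring
    _ ≤ 0 := mul_nonpos_of_nonneg_of_nonpos (hχ z) key

end EpigraphPatch

/-! ### Pointwise bounds in Q and the second tangential moment -/

section Estimates

variable {V : Type*} [NormedAddCommGroup V] [InnerProductSpace ℝ V] [FiniteDimensional ℝ V]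
  [MeasurableSpace V] [BorelSpace V]

/-- A cutoff function `χ` on the base of the patch of `S` over the ball of radius `r`, such that
outside the part of the patch where `χ = 1` the function `offsetSq d` is at least `A⁻¹`. -/
structure IsCutoffPatch (S : Set (V × ℝ)) (g : V → ℝ) (d r η : ℝ) (χ : V → ℝ)
    (χ' : V → V →L[ℝ] ℝ) (A B : ℝ) : Prop where
  d_pos : 0 < d
  r_pos : 0 < r
  η_pos : 0 < η
  A_nonneg : 0 ≤ A
  B_nonneg : 0 ≤ B
  measurableSet : MeasurableSet S
  volume_ne_zero : volume S ≠ 0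
  subset : epigraphPatch g r η ⊆ S
  hasFDerivAt : ∀ z, HasFDerivAt χ (χ' z) z
  continuous_deriv : Continuous χ'
  tsupport_subset : tsupport χ ⊆ Metric.closedBall 0 r
  nonneg : ∀ z, 0 ≤ χ z
  le_one : ∀ z, χ z ≤ 1
  norm_deriv_le : ∀ z, ‖χ' z‖ ≤ B * ‖z‖ ^ 4
  off_patch : ∀ q ∈ S, (q ∈ epigraphPatch g r η ∧ χ q.1 = 1) ∨ 1 ≤ A * offsetSq d q

variable {S : Set (V × ℝ)} {g : V → ℝ} {G : V → V →L[ℝ] ℝ} {H : V →L[ℝ] V →L[ℝ] ℝ}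
  {ρ L M d r η A B : ℝ} {χ : V → ℝ} {χ' : V → V →L[ℝ] ℝ}

theorem IsCutoffPatch.continuous (hχ : IsCutoffPatch S g d r η χ χ' A B) : Continuous χ :=
  continuous_iff_continuousAt.2 fun z => (hχ.hasFDerivAt z).continuousAt

/-- The constant `c` such that the `k`-th moment of `offsetSq` is at most `c * δ ^ k`. -/
noncomputable def momentConst (V : Type*) [NormedAddCommGroup V] [InnerProductSpace ℝ V]
    (k : ℕ) : ℝ := 2 ^ (Module.finrank ℝ V + 1) * (k.factorial * 4 ^ k)

theorem momentConst_nonneg (k : ℕ) : 0 ≤ momentConst V k := by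
  unfold momentConst; positivity

/-- The common mechanism of all error estimates: a pointwise bound by Q or Q² on S becomes a bound
by δ or δ². -/
theorem norm_setIntegral_condGauss_le {E : Type*} [NormedAddCommGroup E] [NormedSpace ℝ E]
    (h : IsLocalEpigraph S g G H ρ L M) (hχ : IsCutoffPatch S g d r η χ χ' A B)
    {D : Set (V × ℝ)} (hD : MeasurableSet D) {f : V × ℝ → E} {a b : ℝ} (ha : 0 ≤ a) (hb : 0 ≤ b)
    {δ : ℝ} (hδ : 0 < δ)
    (hf : ∀ q ∈ S, q ∈ D → ‖f q‖ ≤ a * offsetSq d q + b * offsetSq d q ^ 2) :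
    ‖∫ q in D, f q ∂(condGauss S d δ)‖ ≤
      a * momentConst V 1 * δ + b * momentConst V 2 * δ ^ 2 := by
  have hmem := ae_condGauss_mem hχ.measurableSet d δ
  have hQ := fun k => integrable_offsetSq_pow_and_integral_le hχ.measurableSet hχ.volume_ne_zero
    h.star h.snd_nonneg hχ.d_pos.le hδ k
  obtain ⟨i1, m1⟩ := hQ 1
  obtain ⟨i2, m2⟩ := hQ 2
  simp only [pow_one] at i1 m1
  have hi : Integrable (fun q => a * offsetSq d q + b * offsetSq d q ^ 2) (condGauss S d δ) :=
    (i1.const_mul a).add (i2.const_mul b)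
  calc _ ≤ ∫ q in D, (a * offsetSq d q + b * offsetSq d q ^ 2) ∂(condGauss S d δ) := by
        refine norm_integral_le_of_norm_le hi.integrableOn ?_
        filter_upwards [ae_restrict_mem hD, ae_restrict_of_ae hmem] with q h1 h2 using hf q h2 h1
    _ ≤ ∫ q, (a * offsetSq d q + b * offsetSq d q ^ 2) ∂(condGauss S d δ) := by
        refine setIntegral_le_integral hi ?_
        filter_upwards [hmem] with q hq
        have := offsetSq_nonneg hχ.d_pos.le (h.snd_nonneg q hq)
        simp only [Pi.zero_apply]
        positivity
    _ ≤ a * (momentConst V 1 * δ) + b * (momentConst V 2 * δ ^ 2) := by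
        rw [integral_add (i1.const_mul a) (i2.const_mul b), integral_const_mul,
          integral_const_mul]
        refine add_le_add (mul_le_mul_of_nonneg_left ?_ ha) (mul_le_mul_of_nonneg_left m2 hb)
        simpa only [momentConst, pow_one] using m1
    _ = _ := by ring

theorem norm_integral_condGauss_le {E : Type*} [NormedAddCommGroup E] [NormedSpace ℝ E]
    (h : IsLocalEpigraph S g G H ρ L M) (hχ : IsCutoffPatch S g d r η χ χ' A B)
    {f : V × ℝ → E} {b : ℝ} (hb : 0 ≤ b) {δ : ℝ} (hδ : 0 < δ)
    (hf : ∀ q ∈ S, ‖f q‖ ≤ b * offsetSq d q ^ 2) :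
    ‖∫ q, f q ∂(condGauss S d δ)‖ ≤ b * momentConst V 2 * δ ^ 2 := by
  have := norm_setIntegral_condGauss_le h hχ MeasurableSet.univ (f := f) le_rfl hb hδ
    (fun q hq _ => by simpa using hf q hq)
  simpa using this

theorem integrableOn_patch {E : Type*} [NormedAddCommGroup E] (P : Measure (V × ℝ))
    [IsFiniteMeasure P] (h : IsLocalEpigraph S g G H ρ L M) (hr : r < ρ)
    {f : V × ℝ → E} (hf : ContinuousOn f (Metric.closedBall 0 r ×ˢ univ)) :
    IntegrableOn f (epigraphPatch g r η) P := by
  refine ((hf.mono (prod_mono_right (subset_univ (Icc 0 (L / 2 * r ^ 2 + η))))).integrableOn_compact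
    ((isCompact_closedBall 0 r).prod isCompact_Icc)).mono_set fun q hq => ⟨hq.1, ?_⟩
  have hz := Metric.closedBall_subset_ball hr hq.1
  have h1 := h.nonneg _ hz
  have h2 := h.le_sq _ hz
  have h3 : ‖q.1‖ ^ 2 ≤ r ^ 2 := by
    have := mem_closedBall_zero_iff.1 hq.1
    gcongr
  have h4 := mul_le_mul_of_nonneg_left h3 (by linarith [h.L_nonneg] : 0 ≤ L / 2)
  have h5 := hq.2.1
  have h6 := hq.2.2
  constructor <;> linarith

theorem epigraphPatch_bounds (h : IsLocalEpigraph S g G H ρ L M)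
    (hχ : IsCutoffPatch S g d r η χ χ' A B) (hr : r < ρ) {q : V × ℝ}
    (hq : q ∈ epigraphPatch g r η) :
    ‖q.1‖ ≤ r ∧ ‖q.1‖ ^ 2 ≤ offsetSq d q ∧ 0 ≤ q.2 ∧ q.2 ≤ (2 * d)⁻¹ * offsetSq d q ∧
      q.1 ∈ Metric.ball (0 : V) ρ ∧ g q.1 ≤ q.2 := by
  have hs := h.snd_nonneg q (hχ.subset hq)
  refine ⟨mem_closedBall_zero_iff.1 hq.1, norm_fst_sq_le_offsetSq hχ.d_pos.le hs, hs, ?_,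
    Metric.closedBall_subset_ball hr hq.1, by linarith [hq.2.1]⟩
  have hd := hχ.d_pos
  rw [le_inv_mul_iff₀ (by positivity)]
  exact snd_le_offsetSq

/-- The fourth-order bound on `χ'` is chosen for this: ‖z‖⁴ ≤ Q² makes every term containing the
derivative of the cutoff negligible. -/
theorem norm_cutoff_deriv_le (h : IsLocalEpigraph S g G H ρ L M)
    (hχ : IsCutoffPatch S g d r η χ χ' A B) (hr : r < ρ) {q : V × ℝ}
    (hq : q ∈ epigraphPatch g r η) (u : V) :
    |χ' q.1 u| ≤ B * offsetSq d q ^ 2 * ‖u‖ := by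
  obtain ⟨-, h2, -⟩ := epigraphPatch_bounds h hχ hr hq
  refine ((χ' q.1).le_opNorm u).trans (mul_le_mul_of_nonneg_right ?_ (norm_nonneg u))
  refine (hχ.norm_deriv_le q.1).trans (mul_le_mul_of_nonneg_left ?_ hχ.B_nonneg)
  calc ‖q.1‖ ^ 4 = (‖q.1‖ ^ 2) ^ 2 := by ring
    _ ≤ _ := by gcongr

/-- Integrate by parts against the radial field z, whose divergence is the dimension. The curvature
term (d + s)G(z)z is nonnegative by convexity and may be dropped. -/
theorem integral_cutoff_norm_sq_le (h : IsLocalEpigraph S g G H ρ L M)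
    (hχ : IsCutoffPatch S g d r η χ χ' A B) (hr : r < ρ) :
    ∃ K : ℝ, ∀ δ : ℝ, 0 < δ → δ ≤ 1 →
      ∫ q in epigraphPatch g r η, χ q.1 * ‖q.1‖ ^ 2 ∂(condGauss S d δ) ≤
        Module.finrank ℝ V * δ + K * δ ^ 2 := by
  refine ⟨B * r * momentConst V 2, fun δ hδ hδ1 => ?_⟩
  have := isProbabilityMeasure_condGauss hχ.volume_ne_zero d hδ
  have hgc := h.continuousOn_closedBall hr
  have hDm := measurableSet_epigraphPatch η hgc
  have hGc := h.continuousOn.mono (Metric.closedBall_subset_ball hr)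
  have hχc := hχ.continuous
  have hfst : ContinuousOn (Prod.fst : V × ℝ → V) (Metric.closedBall (0 : V) r ×ˢ univ) :=
    continuousOn_fst
  have hmaps : MapsTo (Prod.fst : V × ℝ → V) (Metric.closedBall (0 : V) r ×ˢ univ)
    (Metric.closedBall (0 : V) r) := fun p hp => hp.1
  have cG : ContinuousOn (fun p : V × ℝ => G p.1) (Metric.closedBall (0 : V) r ×ˢ univ) :=
    hGc.comp hfst hmaps
  have cG' : ContinuousOn (fun p : V × ℝ => G p.1 p.1) (Metric.closedBall (0 : V) r ×ˢ univ) :=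
    cG.clm_apply continuousOn_fst
  have cχ : ContinuousOn (fun p : V × ℝ => χ p.1) (Metric.closedBall (0 : V) r ×ˢ univ) :=
    hχc.comp_continuousOn hfst
  have cχ' : ContinuousOn (fun p : V × ℝ => χ' p.1) (Metric.closedBall (0 : V) r ×ˢ univ) :=
    hχ.continuous_deriv.comp_continuousOn hfst
  have cχ'' : ContinuousOn (fun p : V × ℝ => χ' p.1 p.1)
      (Metric.closedBall (0 : V) r ×ˢ univ) := cχ'.clm_apply continuousOn_fst
  set P := condGauss S d δ
  set D := epigraphPatch g r η
  let e := stdOrthonormalBasis ℝ V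
  -- Sum the directional identities with direction eᵢ and linear weight ⟨eᵢ, z⟩ over an orthonormal
  -- basis.
  have ident : ∫ q in D, (χ q.1 * (δ * Module.finrank ℝ V - (‖q.1‖ ^ 2 + (d + q.2) * G q.1 q.1))
      + δ * χ' q.1 q.1) ∂P = 0 := by
    have key := fun i => integral_condGauss_patch_deriv h hr hχ.subset hχ.hasFDerivAt
      hχ.continuous_deriv hχ.tsupport_subset d hδ 0
      ((innerSL ℝ (e i)).comp (ContinuousLinearMap.fst ℝ V ℝ)) (e i)
    have hsum := Finset.sum_congr rfl fun i (_ : i ∈ Finset.univ) => key i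
    rw [Finset.sum_const_zero, ← integral_finsetSum] at hsum
    · rw [← hsum]
      refine integral_congr_ae (ae_of_all _ fun q => ?_)
      have hT : ∀ T : V →L[ℝ] ℝ, ∑ i, T (e i) * inner ℝ (e i) q.1 = T q.1 := by
        intro T
        conv_rhs => rw [← e.sum_repr' q.1, map_sum]
        simp [mul_comm]
      have h1 := hT (innerSL ℝ q.1)
      have h2 := hT (G q.1)
      have h3 := hT (χ' q.1)
      have h4 : (∑ _i : Fin (Module.finrank ℝ V), (1 : ℝ)) = Module.finrank ℝ V := by simp
      have h1' : ‖q.1‖ ^ 2 = ∑ i, inner ℝ q.1 (e i) * inner ℝ (e i) q.1 := by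
        rw [← real_inner_self_eq_norm_sq]
        simpa using h1.symm
      beta_reduce
      rw [← h4, h1', ← h2, ← h3]
      simp only [Finset.mul_sum, ← Finset.sum_sub_distrib, ← Finset.sum_add_distrib]
      refine Finset.sum_congr rfl fun i _ => ?_
      simp [e.orthonormal.1 i]
      ring
    · intro i _
      refine integrableOn_patch P h hr ?_
      have c1 : ContinuousOn (fun p : V × ℝ => G p.1 (e i))
        (Metric.closedBall (0 : V) r ×ˢ univ) := cG.clm_apply continuousOn_const
      have c2 : ContinuousOn (fun p : V × ℝ => χ' p.1 (e i))
        (Metric.closedBall (0 : V) r ×ˢ univ) := cχ'.clm_apply continuousOn_const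
      have c3 : Continuous fun q : V × ℝ => inner ℝ (e i) q.1 := by fun_prop
      have c4 : Continuous fun q : V × ℝ => inner ℝ q.1 (e i) := by fun_prop
      change ContinuousOn (fun q : V × ℝ => χ q.1 * (δ * inner ℝ (e i) (e i) -
        (0 + inner ℝ (e i) q.1) * (inner ℝ q.1 (e i) + (d + q.2) * G q.1 (e i))) +
        δ * χ' q.1 (e i) * (0 + inner ℝ (e i) q.1)) _
      exact (cχ.mul (continuousOn_const.sub ((continuousOn_const.add c3.continuousOn).mul
        (c4.continuousOn.add ((continuousOn_const.add continuousOn_snd).mul c1))))).add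
        ((continuousOn_const.mul c2).mul (continuousOn_const.add c3.continuousOn))
  have hi1 : IntegrableOn (fun q => χ q.1 * ‖q.1‖ ^ 2) D P := integrableOn_patch P h hr (by fun_prop)
  have hi2 : IntegrableOn (fun q => δ * Module.finrank ℝ V * χ q.1) D P :=
    integrableOn_patch P h hr (by fun_prop)
  have hi3 : IntegrableOn (fun q => δ * χ' q.1 q.1) D P :=
    integrableOn_patch P h hr (continuousOn_const.mul cχ'')
  have hi23 : IntegrableOn (fun q => δ * Module.finrank ℝ V * χ q.1 + δ * χ' q.1 q.1) D P :=
    hi2.add hi3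
  have hi4 : IntegrableOn (fun q => χ q.1 * (δ * Module.finrank ℝ V -
      (‖q.1‖ ^ 2 + (d + q.2) * G q.1 q.1)) + δ * χ' q.1 q.1) D P :=
    integrableOn_patch P h hr ((cχ.mul (continuousOn_const.sub (ContinuousOn.add (by fun_prop)
      ((continuousOn_const.add continuousOn_snd).mul cG')))).add (continuousOn_const.mul cχ''))
  have hle : ∫ q in D, χ q.1 * ‖q.1‖ ^ 2 ∂P ≤
      ∫ q in D, (δ * Module.finrank ℝ V * χ q.1 + δ * χ' q.1 q.1) ∂P := by
    rw [← sub_nonneg, ← integral_sub hi23 hi1, ← ident]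
    refine setIntegral_mono_on hi4 (hi23.sub hi1) hDm fun q hq => ?_
    obtain ⟨-, -, hs, -, hb, -⟩ := epigraphPatch_bounds h hχ hr hq
    have := mul_nonneg (hχ.nonneg q.1) (mul_nonneg (add_nonneg hχ.d_pos.le hs)
      (h.radial_nonneg _ hb))
    nlinarith
  rw [integral_add hi2 hi3, integral_const_mul] at hle
  have hχ1 : ∫ q in D, χ q.1 ∂P ≤ 1 := by
    calc _ ≤ ∫ q in D, (1 : ℝ) ∂P :=
          setIntegral_mono_on (integrableOn_patch P h hr (by fun_prop))
            (integrableOn_const (measure_ne_top _ _)) hDm fun q _ => hχ.le_one q.1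
      _ ≤ 1 := by simp
  have htail : ‖∫ q in D, δ * χ' q.1 q.1 ∂P‖ ≤
      0 * momentConst V 1 * δ + (B * r) * momentConst V 2 * δ ^ 2 := by
    refine norm_setIntegral_condGauss_le h hχ hDm le_rfl
      (mul_nonneg hχ.B_nonneg hχ.r_pos.le) hδ fun q _ hq => ?_
    have h1 := norm_cutoff_deriv_le h hχ hr hq q.1
    obtain ⟨h2, -⟩ := epigraphPatch_bounds h hχ hr hq
    rw [norm_mul, Real.norm_of_nonneg hδ.le, Real.norm_eq_abs]
    calc δ * |χ' q.1 q.1| ≤ 1 * (B * offsetSq d q ^ 2 * ‖q.1‖) := by gcongr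
      _ ≤ 1 * (B * offsetSq d q ^ 2 * r) := by
        have := hχ.B_nonneg
        gcongr
      _ = _ := by ring
  have h5 := (Real.le_norm_self _).trans htail
  have h6 : δ * Module.finrank ℝ V * ∫ q in D, χ q.1 ∂P ≤ δ * Module.finrank ℝ V * 1 := by gcongr
  linarith

end Estimates

/-! ### First moments: tangential and normal means -/

section FirstMoments

variable {V : Type*} [NormedAddCommGroup V] [InnerProductSpace ℝ V] [FiniteDimensional ℝ V]
  [MeasurableSpace V] [BorelSpace V]

variable {S : Set (V × ℝ)} {g : V → ℝ} {G : V → V →L[ℝ] ℝ} {H : V →L[ℝ] V →L[ℝ] ℝ}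
  {ρ L M d r η A B : ℝ} {χ : V → ℝ} {χ' : V → V →L[ℝ] ℝ}

/-- The form I + dH is bounded below by I, so inverting it costs no constant. -/
theorem norm_le_of_coercive (hd : 0 ≤ d) {a : V} (hH : 0 ≤ H a a) {K : ℝ} (hK : 0 ≤ K)
    (h : inner ℝ a a + d * H a a ≤ K * ‖a‖) : ‖a‖ ≤ K := by
  rw [real_inner_self_eq_norm_sq] at h
  have h1 := mul_nonneg hd hH
  by_contra! hlt
  nlinarith [norm_nonneg a]

/-- An integration by parts along the graph of `g`, for the mean of `z` weighted by the cutoff `χ`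
and an affine function `c + l`. -/
theorem patch_moment_identity (h : IsLocalEpigraph S g G H ρ L M)
    (hχ : IsCutoffPatch S g d r η χ χ' A B) (hr : r < ρ) {δ : ℝ} (hδ : 0 < δ) (c : ℝ)
    (l : V × ℝ →L[ℝ] ℝ) (u : V) {a : V}
    (ha : a = ∫ q in epigraphPatch g r η, (χ q.1 * (c + l q)) • q.1 ∂(condGauss S d δ)) :
    inner ℝ a u + d * H a u =
      (∫ q in epigraphPatch g r η, δ * (χ q.1 * l (u, G q.1 u)) ∂(condGauss S d δ)) -
      (∫ q in epigraphPatch g r η, d * (χ q.1 * (c + l q) * (G q.1 - H q.1) u)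
        ∂(condGauss S d δ)) -
      (∫ q in epigraphPatch g r η, χ q.1 * (c + l q) * (q.2 * G q.1 u) ∂(condGauss S d δ)) +
      ∫ q in epigraphPatch g r η, δ * (χ' q.1 u * (c + l q)) ∂(condGauss S d δ) := by
  have := isProbabilityMeasure_condGauss hχ.volume_ne_zero d hδ
  have key := integral_condGauss_patch_deriv h hr hχ.subset hχ.hasFDerivAt
      hχ.continuous_deriv hχ.tsupport_subset d hδ c l u
  have hGc := h.continuousOn.mono (Metric.closedBall_subset_ball hr)
  have hfst : ContinuousOn (Prod.fst : V × ℝ → V) (Metric.closedBall (0 : V) r ×ˢ univ) :=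
    continuousOn_fst
  have cG : ContinuousOn (fun p : V × ℝ => G p.1 u) (Metric.closedBall (0 : V) r ×ˢ univ) :=
    (hGc.comp hfst fun p hp => hp.1).clm_apply continuousOn_const
  have cH : Continuous fun p : V × ℝ => H p.1 u :=
    (H.continuous.comp continuous_fst).clm_apply continuous_const
  have cR : ContinuousOn (fun p : V × ℝ => (G p.1 - H p.1) u)
      (Metric.closedBall (0 : V) r ×ˢ univ) := cG.sub cH.continuousOn
  have cχ : ContinuousOn (fun p : V × ℝ => χ p.1) (Metric.closedBall (0 : V) r ×ˢ univ) :=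
    hχ.continuous.comp_continuousOn hfst
  have cχ' : ContinuousOn (fun p : V × ℝ => χ' p.1 u) (Metric.closedBall (0 : V) r ×ˢ univ) :=
    (hχ.continuous_deriv.comp_continuousOn hfst).clm_apply continuousOn_const
  have cl : ContinuousOn (fun p : V × ℝ => l (u, G p.1 u))
      (Metric.closedBall (0 : V) r ×ˢ univ) :=
    l.continuous.comp_continuousOn (continuousOn_const.prodMk cG)
  have cp : ContinuousOn (fun p : V × ℝ => c + l p) (Metric.closedBall (0 : V) r ×ˢ univ) :=
    (continuous_const.add l.continuous).continuousOn
  set P := condGauss S d δ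
  set D := epigraphPatch g r η
  have i0 : IntegrableOn (fun q => (χ q.1 * (c + l q)) • q.1) D P :=
    integrableOn_patch P h hr ((cχ.mul cp).smul hfst)
  have i1 : IntegrableOn (fun q => δ * (χ q.1 * l (u, G q.1 u))) D P :=
    integrableOn_patch P h hr (continuousOn_const.mul (cχ.mul cl))
  have i2 : IntegrableOn (fun q => d * (χ q.1 * (c + l q) * (G q.1 - H q.1) u)) D P :=
    integrableOn_patch P h hr (continuousOn_const.mul ((cχ.mul cp).mul cR))
  have i3 : IntegrableOn (fun q => χ q.1 * (c + l q) * (q.2 * G q.1 u)) D P :=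
    integrableOn_patch P h hr ((cχ.mul cp).mul (continuousOn_snd.mul cG))
  have i4 : IntegrableOn (fun q => δ * (χ' q.1 u * (c + l q))) D P :=
    integrableOn_patch P h hr (continuousOn_const.mul (cχ'.mul cp))
  -- This functional commutes with the integral and collects the part of the identity that is linear
  -- in z; the difference G - H and the factor s go to the remainders.
  let Λ : V →L[ℝ] ℝ := innerSL ℝ u + d • H.flip u
  have hΛ : ∀ v, Λ v = inner ℝ v u + d * H v u := fun v => by
    simp [Λ, real_inner_comm]
  have i5 : IntegrableOn (fun q => Λ ((χ q.1 * (c + l q)) • q.1)) D P := Λ.integrable_comp i0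
  have i12 := i1.sub i2
  have i123 := i12.sub i3
  have i1234 := i123.add i4
  rw [← hΛ, ha, ← Λ.integral_comp_comm i0, ← integral_sub' i1 i2, ← integral_sub' i12 i3,
    ← integral_add' i123 i4, ← sub_eq_zero, ← integral_sub' i5 i1234, ← neg_eq_zero,
    ← integral_neg, ← key]
  refine integral_congr_ae (ae_of_all _ fun q => ?_)
  simp only [hΛ, Pi.sub_apply, Pi.add_apply, map_smul, real_inner_smul_left,
    smul_apply, sub_apply, smul_eq_mul]
  ring

theorem patch_remainder_bounds (h : IsLocalEpigraph S g G H ρ L M)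
    (hχ : IsCutoffPatch S g d r η χ χ' A B) (hr : r < ρ) {q : V × ℝ}
    (hq : q ∈ epigraphPatch g r η) (u : V) :
    |(G q.1 - H q.1) u| ≤ M / 2 * ‖q.1‖ ^ 2 * ‖u‖ ∧
    |(G q.1 - H q.1) u| ≤ M / 2 * offsetSq d q * ‖u‖ ∧ |G q.1 u| ≤ L * r * ‖u‖ ∧
    |χ q.1| ≤ 1 ∧ |q.2| ≤ (2 * d)⁻¹ * offsetSq d q ∧ 0 ≤ offsetSq d q := by
  obtain ⟨h1, h2, h3, h4, h5, h6⟩ := epigraphPatch_bounds h hχ hr hq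
  have e1 : |(G q.1 - H q.1) u| ≤ M / 2 * ‖q.1‖ ^ 2 * ‖u‖ :=
    ((G q.1 - H q.1).le_opNorm u).trans
      (mul_le_mul_of_nonneg_right (h.norm_grad_sub_le _ h5) (norm_nonneg u))
  have hM := h.M_nonneg
  have hL := h.L_nonneg
  refine ⟨e1, e1.trans (by gcongr), ?_, ?_, ?_, offsetSq_nonneg hχ.d_pos.le h3⟩
  · refine ((G q.1).le_opNorm u).trans (mul_le_mul_of_nonneg_right ?_ (norm_nonneg u))
    exact (h.norm_grad_le _ h5).trans (by gcongr)
  · rw [abs_of_nonneg (hχ.nonneg _)]; exact hχ.le_one _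
  · rwa [abs_of_nonneg h3]

/-- A crude bound, with ‖G‖ ≤ Lr on the patch and s ≤ Q/(2d). It already improves on the order √δ
suggested by E‖z‖² = O(δ), and it feeds the estimate of the mixed moment. -/
theorem norm_patch_fst_le (h : IsLocalEpigraph S g G H ρ L M)
    (hχ : IsCutoffPatch S g d r η χ χ' A B) (hr : r < ρ) :
    ∃ K : ℝ, 0 ≤ K ∧ ∀ δ : ℝ, 0 < δ → δ ≤ 1 →
      ‖∫ q in epigraphPatch g r η, χ q.1 • q.1 ∂(condGauss S d δ)‖ ≤ K * δ := by
  have hM := h.M_nonneg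
  have hL := h.L_nonneg
  have hd := hχ.d_pos
  have hr0 := hχ.r_pos
  have hB := hχ.B_nonneg
  have hm1 := momentConst_nonneg (V := V) 1
  have hm2 := momentConst_nonneg (V := V) 2
  refine ⟨d * (M / 2) * momentConst V 1 + (2 * d)⁻¹ * (L * r) * momentConst V 1 +
    B * momentConst V 2, by positivity, fun δ hδ hδ1 => ?_⟩
  set a := ∫ q in epigraphPatch g r η, χ q.1 • q.1 ∂(condGauss S d δ) with ha
  have hDm := measurableSet_epigraphPatch η (h.continuousOn_closedBall hr)
  refine norm_le_of_coercive hd.le (h.quadratic_nonneg a) (by positivity) ?_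
  have key := patch_moment_identity h hχ hr hδ 1 0 a (a := a) (by simp [ha])
  simp only [zero_apply, add_zero, mul_one, mul_zero, integral_zero,
    zero_sub] at key
  have b1 := norm_setIntegral_condGauss_le h hχ hDm (a := d * (M / 2) * ‖a‖) (b := 0)
    (by positivity) le_rfl hδ (f := fun q => d * (χ q.1 * (G q.1 - H q.1) a)) fun q _ hq => by
      obtain ⟨-, h2, -, h4, -, h6⟩ := patch_remainder_bounds h hχ hr hq a
      rw [Real.norm_eq_abs, abs_mul, abs_mul, abs_of_pos hd]
      calc d * (|χ q.1| * |(G q.1 - H q.1) a|) ≤ d * (1 * (M / 2 * offsetSq d q * ‖a‖)) := by gcongr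
        _ = _ := by ring
  have b2 := norm_setIntegral_condGauss_le h hχ hDm (a := (2 * d)⁻¹ * (L * r) * ‖a‖) (b := 0)
    (by positivity) le_rfl hδ (f := fun q => χ q.1 * (q.2 * G q.1 a)) fun q _ hq => by
      obtain ⟨-, -, h3, h4, h5, h6⟩ := patch_remainder_bounds h hχ hr hq a
      rw [Real.norm_eq_abs, abs_mul, abs_mul]
      calc |χ q.1| * (|q.2| * |G q.1 a|) ≤ 1 * ((2 * d)⁻¹ * offsetSq d q * (L * r * ‖a‖)) := by
            gcongr
        _ = _ := by ring
  have b3 := norm_setIntegral_condGauss_le h hχ hDm (a := 0) (b := B * ‖a‖)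
    le_rfl (by positivity) hδ (f := fun q => δ * χ' q.1 a) fun q _ hq => by
      have := norm_cutoff_deriv_le h hχ hr hq a
      rw [Real.norm_eq_abs, abs_mul, abs_of_pos hδ]
      calc δ * |χ' q.1 a| ≤ 1 * (B * offsetSq d q ^ 2 * ‖a‖) := by gcongr
        _ = _ := by ring
  rw [Real.norm_eq_abs] at b1 b2 b3
  have hsq : B * ‖a‖ * momentConst V 2 * δ ^ 2 ≤ B * ‖a‖ * momentConst V 2 * δ := by
    refine mul_le_mul_of_nonneg_left ?_ (by positivity)
    nlinarith
  rw [key]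
  linarith [(abs_le.1 b1).1, (abs_le.1 b2).1, (abs_le.1 b3).2]

/-- With weight s, differentiating the weight along a layer yields δE[χ G(z)u]. This is O(δ²)
because E[χz] = O(δ) and the nonlinear part of G is quadratic. The other terms carry two factors of
order Q. -/
theorem norm_patch_snd_smul_fst_le (h : IsLocalEpigraph S g G H ρ L M)
    (hχ : IsCutoffPatch S g d r η χ χ' A B) (hr : r < ρ) :
    ∃ K : ℝ, 0 ≤ K ∧ ∀ δ : ℝ, 0 < δ → δ ≤ 1 →
      ‖∫ q in epigraphPatch g r η, (χ q.1 * q.2) • q.1 ∂(condGauss S d δ)‖ ≤ K * δ ^ 2 := by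
  obtain ⟨K₁, hK₁, hK⟩ := norm_patch_fst_le h hχ hr
  have hM := h.M_nonneg
  have hL := h.L_nonneg
  have hd := hχ.d_pos
  have hr0 := hχ.r_pos
  have hη := hχ.η_pos
  have hB := hχ.B_nonneg
  have hm1 := momentConst_nonneg (V := V) 1
  have hm2 := momentConst_nonneg (V := V) 2
  refine ⟨‖H‖ * K₁ + M / 2 * momentConst V 1 + d * (2 * d)⁻¹ * (M / 2) * momentConst V 2 +
    (2 * d)⁻¹ ^ 2 * (L * r) * momentConst V 2 + B * (L / 2 * r ^ 2 + η) * momentConst V 2,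
    by positivity, fun δ hδ hδ1 => ?_⟩
  have := isProbabilityMeasure_condGauss hχ.volume_ne_zero d hδ
  set b := ∫ q in epigraphPatch g r η, (χ q.1 * q.2) • q.1 ∂(condGauss S d δ) with hb
  have hDm := measurableSet_epigraphPatch η (h.continuousOn_closedBall hr)
  refine norm_le_of_coercive hd.le (h.quadratic_nonneg b) (by positivity) ?_
  have key := patch_moment_identity h hχ hr hδ 0 (ContinuousLinearMap.snd ℝ V ℝ) b (a := b)
    (by simp [hb])
  simp only [ContinuousLinearMap.coe_snd', zero_add] at key
  have hGc := h.continuousOn.mono (Metric.closedBall_subset_ball hr)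
  have hfst : ContinuousOn (Prod.fst : V × ℝ → V) (Metric.closedBall (0 : V) r ×ˢ univ) :=
    continuousOn_fst
  have cG : ContinuousOn (fun p : V × ℝ => G p.1 b) (Metric.closedBall (0 : V) r ×ˢ univ) :=
    (hGc.comp hfst fun p hp => hp.1).clm_apply continuousOn_const
  have cH : Continuous fun p : V × ℝ => H p.1 b :=
    (H.continuous.comp continuous_fst).clm_apply continuous_const
  have cχ : ContinuousOn (fun p : V × ℝ => χ p.1) (Metric.closedBall (0 : V) r ×ˢ univ) :=
    hχ.continuous.comp_continuousOn hfst
  have i1 : IntegrableOn (fun q => χ q.1 • q.1) (epigraphPatch g r η) (condGauss S d δ) :=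
    integrableOn_patch _ h hr (cχ.smul hfst)
  have i2 : IntegrableOn (fun q => χ q.1 * (G q.1 - H q.1) b) (epigraphPatch g r η)
      (condGauss S d δ) := integrableOn_patch _ h hr (cχ.mul (cG.sub cH.continuousOn))
  have i3 := (H.flip b).integrable_comp i1
  have split : ∫ q in epigraphPatch g r η, δ * (χ q.1 * G q.1 b) ∂(condGauss S d δ) =
      δ * (H (∫ q in epigraphPatch g r η, χ q.1 • q.1 ∂(condGauss S d δ)) b +
        ∫ q in epigraphPatch g r η, χ q.1 * (G q.1 - H q.1) b ∂(condGauss S d δ)) := by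
    rw [integral_const_mul, ← ContinuousLinearMap.flip_apply H, ← (H.flip b).integral_comp_comm i1,
      ← integral_add i3 i2]
    congr 1
    refine integral_congr_ae (ae_of_all _ fun q => ?_)
    simp
    ring
  rw [split] at key
  have b0 : H (∫ q in epigraphPatch g r η, χ q.1 • q.1 ∂(condGauss S d δ)) b ≤
      ‖H‖ * (K₁ * δ) * ‖b‖ := by
    refine (Real.le_norm_self _).trans ((H.le_opNorm₂ _ _).trans ?_)
    have := hK δ hδ hδ1
    gcongr
  have b1 := norm_setIntegral_condGauss_le h hχ hDm (a := M / 2 * ‖b‖) (b := 0)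
    (by positivity) le_rfl hδ (f := fun q => χ q.1 * (G q.1 - H q.1) b) fun q _ hq => by
      obtain ⟨-, h2, -, h4, -, h6⟩ := patch_remainder_bounds h hχ hr hq b
      rw [Real.norm_eq_abs, abs_mul]
      calc |χ q.1| * |(G q.1 - H q.1) b| ≤ 1 * (M / 2 * offsetSq d q * ‖b‖) := by gcongr
        _ = _ := by ring
  have b2 := norm_setIntegral_condGauss_le h hχ hDm (a := 0)
    (b := d * (2 * d)⁻¹ * (M / 2) * ‖b‖) le_rfl (by positivity) hδ
    (f := fun q => d * (χ q.1 * q.2 * (G q.1 - H q.1) b)) fun q _ hq => by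
      obtain ⟨-, h2, -, h4, h5, h6⟩ := patch_remainder_bounds h hχ hr hq b
      rw [Real.norm_eq_abs, abs_mul, abs_mul, abs_mul, abs_of_pos hd]
      calc d * (|χ q.1| * |q.2| * |(G q.1 - H q.1) b|) ≤
            d * (1 * ((2 * d)⁻¹ * offsetSq d q) * (M / 2 * offsetSq d q * ‖b‖)) := by gcongr
        _ = _ := by ring
  have b3 := norm_setIntegral_condGauss_le h hχ hDm (a := 0)
    (b := (2 * d)⁻¹ ^ 2 * (L * r) * ‖b‖) le_rfl (by positivity) hδ
    (f := fun q => χ q.1 * q.2 * (q.2 * G q.1 b)) fun q _ hq => by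
      obtain ⟨-, -, h3, h4, h5, h6⟩ := patch_remainder_bounds h hχ hr hq b
      rw [Real.norm_eq_abs, abs_mul, abs_mul, abs_mul]
      calc |χ q.1| * |q.2| * (|q.2| * |G q.1 b|) ≤ 1 * ((2 * d)⁻¹ * offsetSq d q) *
            ((2 * d)⁻¹ * offsetSq d q * (L * r * ‖b‖)) := by gcongr
        _ = _ := by ring
  have b4 := norm_setIntegral_condGauss_le h hχ hDm (a := 0)
    (b := B * (L / 2 * r ^ 2 + η) * ‖b‖) le_rfl (by positivity) hδ
    (f := fun q => δ * (χ' q.1 b * q.2)) fun q _ hq => by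
      have h1 := norm_cutoff_deriv_le h hχ hr hq b
      obtain ⟨h2, -, h3, -, h5, -⟩ := epigraphPatch_bounds h hχ hr hq
      have h6 : q.2 ≤ L / 2 * r ^ 2 + η := by
        have e1 := h.le_sq _ h5
        have e2 : L / 2 * ‖q.1‖ ^ 2 ≤ L / 2 * r ^ 2 := by gcongr
        linarith [hq.2.2]
      rw [Real.norm_eq_abs, abs_mul, abs_mul, abs_of_pos hδ, abs_of_nonneg h3]
      calc δ * (|χ' q.1 b| * q.2) ≤
            1 * (B * offsetSq d q ^ 2 * ‖b‖ * (L / 2 * r ^ 2 + η)) := by gcongr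
        _ = _ := by ring
  rw [Real.norm_eq_abs] at b1 b2 b3 b4
  have b01 : δ * (H (∫ q in epigraphPatch g r η, χ q.1 • q.1 ∂(condGauss S d δ)) b +
        ∫ q in epigraphPatch g r η, χ q.1 * (G q.1 - H q.1) b ∂(condGauss S d δ)) ≤
      δ * (‖H‖ * (K₁ * δ) * ‖b‖ + M / 2 * ‖b‖ * momentConst V 1 * δ) := by
    refine mul_le_mul_of_nonneg_left ?_ hδ.le
    linarith [(abs_le.1 b1).2]
  rw [key]
  linarith [(abs_le.1 b2).1, (abs_le.1 b3).1, (abs_le.1 b4).2]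

/-- At order δ only the Taylor remainder of the gradient survives, weighted by the second moment of
z. The term E[χ s G] splits into H applied to the mixed moment plus a remainder bounded by a
multiple of Q². -/
theorem norm_patch_fst_le_sharp (h : IsLocalEpigraph S g G H ρ L M)
    (hχ : IsCutoffPatch S g d r η χ χ' A B) (hr : r < ρ) :
    ∃ K : ℝ, ∀ δ : ℝ, 0 < δ → δ ≤ 1 →
      ‖∫ q in epigraphPatch g r η, χ q.1 • q.1 ∂(condGauss S d δ)‖ ≤
        d * (M / 2) * Module.finrank ℝ V * δ + K * δ ^ 2 := by
  obtain ⟨K₁, hK₁⟩ := integral_cutoff_norm_sq_le h hχ hr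
  obtain ⟨K₂, hK₂, hK⟩ := norm_patch_snd_smul_fst_le h hχ hr
  have hM := h.M_nonneg
  have hL := h.L_nonneg
  have hd := hχ.d_pos
  have hB := hχ.B_nonneg
  have hm2 := momentConst_nonneg (V := V) 2
  refine ⟨d * (M / 2) * K₁ + ‖H‖ * K₂ + (2 * d)⁻¹ * (M / 2) * momentConst V 2 +
    B * momentConst V 2, fun δ hδ hδ1 => ?_⟩
  have := isProbabilityMeasure_condGauss hχ.volume_ne_zero d hδ
  have hDm := measurableSet_epigraphPatch η (h.continuousOn_closedBall hr)
  set a := ∫ q in epigraphPatch g r η, χ q.1 • q.1 ∂(condGauss S d δ) with ha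
  set b := ∫ q in epigraphPatch g r η, (χ q.1 * q.2) • q.1 ∂(condGauss S d δ) with hb
  have hsq : 0 ≤ ∫ q in epigraphPatch g r η, χ q.1 * ‖q.1‖ ^ 2 ∂(condGauss S d δ) :=
    integral_nonneg fun q => mul_nonneg (hχ.nonneg _) (sq_nonneg _)
  suffices hs : ‖a‖ ≤ d * (M / 2) *
      (∫ q in epigraphPatch g r η, χ q.1 * ‖q.1‖ ^ 2 ∂(condGauss S d δ)) +
      (‖H‖ * K₂ + (2 * d)⁻¹ * (M / 2) * momentConst V 2 + B * momentConst V 2) * δ ^ 2 by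
    have := mul_le_mul_of_nonneg_left (hK₁ δ hδ hδ1) (by positivity : 0 ≤ d * (M / 2))
    linarith
  refine norm_le_of_coercive hd.le (h.quadratic_nonneg a) (by positivity) ?_
  have key := patch_moment_identity h hχ hr hδ 1 0 a (a := a) (by simp [ha])
  simp only [zero_apply, add_zero, mul_one, mul_zero, integral_zero,
    zero_sub] at key
  have hGc := h.continuousOn.mono (Metric.closedBall_subset_ball hr)
  have hfst : ContinuousOn (Prod.fst : V × ℝ → V) (Metric.closedBall (0 : V) r ×ˢ univ) :=
    continuousOn_fst
  have cG : ContinuousOn (fun p : V × ℝ => G p.1 a) (Metric.closedBall (0 : V) r ×ˢ univ) :=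
    (hGc.comp hfst fun p hp => hp.1).clm_apply continuousOn_const
  have cH : Continuous fun p : V × ℝ => H p.1 a :=
    (H.continuous.comp continuous_fst).clm_apply continuous_const
  have cχ : ContinuousOn (fun p : V × ℝ => χ p.1) (Metric.closedBall (0 : V) r ×ˢ univ) :=
    hχ.continuous.comp_continuousOn hfst
  have i1 : IntegrableOn (fun q => (χ q.1 * q.2) • q.1) (epigraphPatch g r η) (condGauss S d δ) :=
    integrableOn_patch _ h hr ((cχ.mul continuousOn_snd).smul hfst)
  have i2 : IntegrableOn (fun q => χ q.1 * (q.2 * (G q.1 - H q.1) a)) (epigraphPatch g r η)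
      (condGauss S d δ) :=
    integrableOn_patch _ h hr (cχ.mul (continuousOn_snd.mul (cG.sub cH.continuousOn)))
  have i3 := (H.flip a).integrable_comp i1
  have i4 : IntegrableOn (fun q => d * (M / 2) * ‖a‖ * (χ q.1 * ‖q.1‖ ^ 2)) (epigraphPatch g r η)
      (condGauss S d δ) :=
    integrableOn_patch _ h hr (continuousOn_const.mul (cχ.mul (by fun_prop)))
  have split : ∫ q in epigraphPatch g r η, χ q.1 * (q.2 * G q.1 a) ∂(condGauss S d δ) =
      H b a + ∫ q in epigraphPatch g r η, χ q.1 * (q.2 * (G q.1 - H q.1) a)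
        ∂(condGauss S d δ) := by
    rw [← ContinuousLinearMap.flip_apply H, ← (H.flip a).integral_comp_comm i1,
      ← integral_add i3 i2]
    refine integral_congr_ae (ae_of_all _ fun q => ?_)
    simp
    ring
  rw [split] at key
  have b0 : |H b a| ≤ ‖H‖ * (K₂ * δ ^ 2) * ‖a‖ := by
    refine (H.le_opNorm₂ _ _).trans ?_
    have := hK δ hδ hδ1
    gcongr
  have b1 : ‖∫ q in epigraphPatch g r η, d * (χ q.1 * (G q.1 - H q.1) a) ∂(condGauss S d δ)‖ ≤
      d * (M / 2) * ‖a‖ *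
        ∫ q in epigraphPatch g r η, χ q.1 * ‖q.1‖ ^ 2 ∂(condGauss S d δ) := by
    rw [← integral_const_mul]
    refine norm_integral_le_of_norm_le i4 (ae_restrict_of_forall_mem hDm fun q hq => ?_)
    obtain ⟨h1, -⟩ := patch_remainder_bounds h hχ hr hq a
    have := hχ.nonneg q.1
    rw [Real.norm_eq_abs, abs_mul, abs_mul, abs_of_pos hd, abs_of_nonneg this]
    calc d * (χ q.1 * |(G q.1 - H q.1) a|) ≤ d * (χ q.1 * (M / 2 * ‖q.1‖ ^ 2 * ‖a‖)) := by gcongr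
      _ = _ := by ring
  have b2 := norm_setIntegral_condGauss_le h hχ hDm (a := 0)
    (b := (2 * d)⁻¹ * (M / 2) * ‖a‖) le_rfl (by positivity) hδ
    (f := fun q => χ q.1 * (q.2 * (G q.1 - H q.1) a)) fun q _ hq => by
      obtain ⟨-, h2, -, h4, h5, h6⟩ := patch_remainder_bounds h hχ hr hq a
      rw [Real.norm_eq_abs, abs_mul, abs_mul]
      calc |χ q.1| * (|q.2| * |(G q.1 - H q.1) a|) ≤
            1 * ((2 * d)⁻¹ * offsetSq d q * (M / 2 * offsetSq d q * ‖a‖)) := by gcongr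
        _ = _ := by ring
  have b3 := norm_setIntegral_condGauss_le h hχ hDm (a := 0) (b := B * ‖a‖)
    le_rfl (by positivity) hδ (f := fun q => δ * χ' q.1 a) fun q _ hq => by
      have := norm_cutoff_deriv_le h hχ hr hq a
      rw [Real.norm_eq_abs, abs_mul, abs_of_pos hδ]
      calc δ * |χ' q.1 a| ≤ 1 * (B * offsetSq d q ^ 2 * ‖a‖) := by gcongr
        _ = _ := by ring
  rw [Real.norm_eq_abs] at b1 b2 b3
  rw [key]
  linarith [(abs_le.1 b0).1, (abs_le.1 b1).1, (abs_le.1 b2).1, (abs_le.1 b3).2]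

/-- Split s = (s - g) + g: the fibre inequality controls the first part by δ/d, and g ≤ (L/2)‖z‖²
reduces the second to the tangential second moment. -/
theorem patch_snd_le (h : IsLocalEpigraph S g G H ρ L M)
    (hχ : IsCutoffPatch S g d r η χ χ' A B) (hr : r < ρ) :
    ∃ K : ℝ, ∀ δ : ℝ, 0 < δ → δ ≤ 1 →
      ∫ q in epigraphPatch g r η, χ q.1 * q.2 ∂(condGauss S d δ) ≤
        (L * Module.finrank ℝ V / 2 + 1 / d) * δ + K * δ ^ 2 := by
  obtain ⟨K₁, hK₁⟩ := integral_cutoff_norm_sq_le h hχ hr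
  have hL := h.L_nonneg
  have hd := hχ.d_pos
  refine ⟨L / 2 * K₁, fun δ hδ hδ1 => ?_⟩
  have := isProbabilityMeasure_condGauss hχ.volume_ne_zero d hδ
  have hgc := h.continuousOn_closedBall hr
  have hDm := measurableSet_epigraphPatch η hgc
  have key := integral_condGauss_patch_height h hr hχ.η_pos hχ.subset hχ.continuous hχ.nonneg d hδ
  have hfst : ContinuousOn (Prod.fst : V × ℝ → V) (Metric.closedBall (0 : V) r ×ˢ univ) :=
    continuousOn_fst
  have cg : ContinuousOn (fun p : V × ℝ => g p.1) (Metric.closedBall (0 : V) r ×ˢ univ) :=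
    hgc.comp hfst fun p hp => hp.1
  have cχ : ContinuousOn (fun p : V × ℝ => χ p.1) (Metric.closedBall (0 : V) r ×ˢ univ) :=
    hχ.continuous.comp_continuousOn hfst
  set P := condGauss S d δ
  set D := epigraphPatch g r η
  have i1 : IntegrableOn (fun q => χ q.1 * q.2) D P :=
    integrableOn_patch P h hr (cχ.mul continuousOn_snd)
  have i2 : IntegrableOn (fun q => d⁻¹ * (χ q.1 * (d * (q.2 - g q.1) - δ))) D P :=
    integrableOn_patch P h hr (continuousOn_const.mul (cχ.mul
      ((continuousOn_const.mul (continuousOn_snd.sub cg)).sub continuousOn_const)))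
  have i3 : IntegrableOn (fun q => δ / d * χ q.1) D P :=
    integrableOn_patch P h hr (continuousOn_const.mul cχ)
  have i4 : IntegrableOn (fun q => L / 2 * (χ q.1 * ‖q.1‖ ^ 2)) D P :=
    integrableOn_patch P h hr (continuousOn_const.mul (cχ.mul (by fun_prop)))
  have hle : ∫ q in D, χ q.1 * q.2 ∂P ≤ ∫ q in D, (d⁻¹ * (χ q.1 * (d * (q.2 - g q.1) - δ)) +
      δ / d * χ q.1 + L / 2 * (χ q.1 * ‖q.1‖ ^ 2)) ∂P := by
    refine setIntegral_mono_on i1 ((i2.add i3).add i4) hDm fun q hq => ?_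
    obtain ⟨-, -, -, -, hb, -⟩ := epigraphPatch_bounds h hχ hr hq
    have h1 := mul_le_mul_of_nonneg_left (h.le_sq _ hb) (hχ.nonneg q.1)
    have h2 : d⁻¹ * (χ q.1 * (d * (q.2 - g q.1) - δ)) + δ / d * χ q.1 =
        χ q.1 * (q.2 - g q.1) := by
      field_simp
      ring
    rw [h2]
    linarith
  have i23 : IntegrableOn (fun q => d⁻¹ * (χ q.1 * (d * (q.2 - g q.1) - δ)) + δ / d * χ q.1) D P :=
    i2.add i3
  rw [integral_add i23 i4, integral_add i2 i3, integral_const_mul, integral_const_mul,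
    integral_const_mul] at hle
  have hχ1 : ∫ q in D, χ q.1 ∂P ≤ 1 := by
    calc _ ≤ ∫ q in D, (1 : ℝ) ∂P :=
          setIntegral_mono_on (integrableOn_patch P h hr cχ)
            (integrableOn_const (measure_ne_top _ _)) hDm fun q _ => hχ.le_one q.1
      _ ≤ 1 := by simp
  have e1 := mul_nonpos_of_nonneg_of_nonpos (inv_nonneg.2 hd.le) key
  have e2 : δ / d * ∫ q in D, χ q.1 ∂P ≤ δ / d * 1 := by gcongr
  have e3 : L / 2 * ∫ q in D, χ q.1 * ‖q.1‖ ^ 2 ∂P ≤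
    L / 2 * (Module.finrank ℝ V * δ + K₁ * δ ^ 2) := by
      have := hK₁ δ hδ hδ1
      gcongr
  have e4 : δ / d = 1 / d * δ := by ring
  rw [e4] at hle e2
  linarith

theorem integrable_fst_snd (h : IsLocalEpigraph S g G H ρ L M)
    (hχ : IsCutoffPatch S g d r η χ χ' A B) {δ : ℝ} (hδ : 0 < δ) :
    Integrable (fun q : V × ℝ => q.1) (condGauss S d δ) ∧
    Integrable (fun q : V × ℝ => q.2) (condGauss S d δ) := by
  have := isProbabilityMeasure_condGauss hχ.volume_ne_zero d hδ
  have hmem := ae_condGauss_mem hχ.measurableSet d δ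
  have hd := hχ.d_pos
  obtain ⟨i1, -⟩ := integrable_offsetSq_pow_and_integral_le hχ.measurableSet hχ.volume_ne_zero
    h.star h.snd_nonneg hd.le hδ 1
  simp only [pow_one] at i1
  constructor
  · refine ((integrable_const 1).add i1).mono' continuous_fst.aestronglyMeasurable ?_
    filter_upwards [hmem] with q hq
    have := norm_fst_sq_le_offsetSq hd.le (h.snd_nonneg q hq)
    simp only [Pi.add_apply]
    nlinarith [sq_nonneg (‖q.1‖ - 1)]
  · refine (i1.const_mul (2 * d)⁻¹).mono' continuous_snd.aestronglyMeasurable ?_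
    filter_upwards [hmem] with q hq
    rw [Real.norm_of_nonneg (h.snd_nonneg q hq), le_inv_mul_iff₀ (by positivity)]
    exact snd_le_offsetSq

/-- The two integrands differ only where 1 ≤ AQ, and there powers of AQ can be inserted freely to
turn a + bQ into a multiple of Q². -/
theorem norm_integral_sub_patch_le {E : Type*} [NormedAddCommGroup E] [NormedSpace ℝ E]
    (h : IsLocalEpigraph S g G H ρ L M) (hχ : IsCutoffPatch S g d r η χ χ' A B) (hr : r < ρ)
    {f : V × ℝ → E} (hf : Continuous f) {a b : ℝ} (ha : 0 ≤ a) (hb : 0 ≤ b) {δ : ℝ} (hδ : 0 < δ)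
    (hfi : Integrable f (condGauss S d δ))
    (hle : ∀ q ∈ S, ‖f q‖ ≤ a + b * offsetSq d q) :
    ‖∫ q, f q ∂(condGauss S d δ) - ∫ q in epigraphPatch g r η, χ q.1 • f q ∂(condGauss S d δ)‖ ≤
      (a * A ^ 2 + b * A) * momentConst V 2 * δ ^ 2 := by
  have := isProbabilityMeasure_condGauss hχ.volume_ne_zero d hδ
  have hDm := measurableSet_epigraphPatch η (h.continuousOn_closedBall hr)
  have hi : IntegrableOn (fun q => χ q.1 • f q) (epigraphPatch g r η) (condGauss S d δ) :=
    integrableOn_patch _ h hr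
      ((hχ.continuous.comp continuous_fst).smul hf).continuousOn
  have hA := hχ.A_nonneg
  rw [← integral_indicator hDm, ← integral_sub hfi (hi.integrable_indicator hDm)]
  refine norm_integral_condGauss_le h hχ (by positivity) hδ fun q hq => ?_
  have h0 := offsetSq_nonneg hχ.d_pos.le (h.snd_nonneg q hq)
  rcases hχ.off_patch q hq with ⟨h1, h2⟩ | h1
  · rw [indicator_of_mem h1, h2, one_smul, sub_self, norm_zero]
    positivity
  · have h2 : ‖f q - (epigraphPatch g r η).indicator (fun q => χ q.1 • f q) q‖ ≤ ‖f q‖ := by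
      by_cases hD : q ∈ epigraphPatch g r η
      · rw [indicator_of_mem hD]
        calc ‖f q - χ q.1 • f q‖ = ‖(1 - χ q.1) • f q‖ := by rw [sub_smul, one_smul]
          _ = (1 - χ q.1) * ‖f q‖ := by
            rw [norm_smul, Real.norm_of_nonneg (by linarith [hχ.le_one q.1])]
          _ ≤ 1 * ‖f q‖ := by
            have := hχ.nonneg q.1
            gcongr
            linarith
          _ = _ := one_mul _
      · rw [indicator_of_notMem hD, sub_zero]
    refine (h2.trans (hle q hq)).trans ?_
    set Q := offsetSq d q
    have e1 : 1 ≤ (A * Q) ^ 2 := one_le_pow₀ h1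
    calc a + b * Q = a * 1 + b * Q * 1 := by ring
      _ ≤ a * (A * Q) ^ 2 + b * Q * (A * Q) := by gcongr
      _ = _ := by ring

/-- The mean of a Gaussian law conditioned on a set with a local `C²` boundary chart. -/
theorem condGauss_mean_bounds (h : IsLocalEpigraph S g G H ρ L M)
    (hχ : IsCutoffPatch S g d r η χ χ' A B) (hr : r < ρ) :
    ∃ K₁ K₂ : ℝ, ∀ δ : ℝ, 0 < δ → δ ≤ 1 →
      Integrable (fun q : V × ℝ => q.1) (condGauss S d δ) ∧
      Integrable (fun q : V × ℝ => q.2) (condGauss S d δ) ∧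
      ‖∫ q, q.1 ∂(condGauss S d δ)‖ ≤ d * (M / 2) * Module.finrank ℝ V * δ + K₁ * δ ^ 2 ∧
      |∫ q, q.2 ∂(condGauss S d δ)| ≤ (L * Module.finrank ℝ V / 2 + 1 / d) * δ + K₂ * δ ^ 2 := by
  obtain ⟨K₁, hK₁⟩ := norm_patch_fst_le_sharp h hχ hr
  obtain ⟨K₂, hK₂⟩ := patch_snd_le h hχ hr
  have hd := hχ.d_pos
  refine ⟨K₁ + (1 * A ^ 2 + 1 * A) * momentConst V 2,
    K₂ + (0 * A ^ 2 + (2 * d)⁻¹ * A) * momentConst V 2, fun δ hδ hδ1 => ?_⟩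
  obtain ⟨i1, i2⟩ := integrable_fst_snd h hχ hδ
  -- The constants a = b = 1 come from ‖z‖ ≤ 1 + ‖z‖² ≤ 1 + Q.
  have t1 := norm_integral_sub_patch_le h hχ hr continuous_fst zero_le_one zero_le_one hδ i1
    fun q hq => by
      have := norm_fst_sq_le_offsetSq hd.le (h.snd_nonneg q hq)
      nlinarith [sq_nonneg (‖q.1‖ - 1)]
  have t2 := norm_integral_sub_patch_le h hχ hr continuous_snd le_rfl
    (by positivity : 0 ≤ (2 * d)⁻¹) hδ i2 fun q hq => by
      rw [Real.norm_of_nonneg (h.snd_nonneg q hq), zero_add, le_inv_mul_iff₀ (by positivity)]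
      exact snd_le_offsetSq
  refine ⟨i1, i2, ?_, ?_⟩
  · have := norm_le_norm_add_norm_sub' (∫ q, q.1 ∂(condGauss S d δ))
      (∫ q in epigraphPatch g r η, χ q.1 • q.1 ∂(condGauss S d δ))
    linarith [hK₁ δ hδ hδ1]
  · have hnn : 0 ≤ ∫ q, q.2 ∂(condGauss S d δ) := integral_nonneg_of_ae (by
      filter_upwards [ae_condGauss_mem hχ.measurableSet d δ] with q hq using h.snd_nonneg q hq)
    rw [abs_of_nonneg hnn]
    simp only [smul_eq_mul, Real.norm_eq_abs] at t2
    linarith [hK₂ δ hδ hδ1, (abs_le.1 t2).2]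

end FirstMoments

/-! ### Taylor bounds for the boundary profile -/

section Profile

variable {V : Type*} [NormedAddCommGroup V] [NormedSpace ℝ V]

theorem smul_mem_ball_of_mem_Icc {ρ t : ℝ} {z : V} (hz : z ∈ Metric.ball (0 : V) ρ)
    (ht : t ∈ Icc (0 : ℝ) 1) : t • z ∈ Metric.ball (0 : V) ρ := by
  rw [mem_ball_zero_iff] at hz ⊢
  rw [norm_smul, Real.norm_of_nonneg ht.1]
  nlinarith [norm_nonneg z, ht.2]

theorem hasDerivAt_smul_const_id (z : V) (t : ℝ) : HasDerivAt (fun s : ℝ => s • z) z t := by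
  simpa using (hasDerivAt_id t).smul_const z

/-- On the ray t ↦ h(tz), the chord slope over [0, 1] lies between the derivative at 1 and the
derivative at 0, which vanishes. -/
theorem ConcaveOn.le_and_deriv_le_of_critical {h : V → ℝ} {D : V → V →L[ℝ] ℝ} {ρ : ℝ}
    (hconc : ConcaveOn ℝ (Metric.ball 0 ρ) h)
    (hD : ∀ z ∈ Metric.ball (0 : V) ρ, HasFDerivAt h (D z) z) (h0 : h 0 = 0) (hD0 : D 0 = 0)
    {z : V} (hz : z ∈ Metric.ball (0 : V) ρ) : h z ≤ 0 ∧ D z z ≤ h z := by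
  have hφ := hconc.comp_linearMap (LinearMap.toSpanSingleton ℝ V z)
  have hm : ∀ t ∈ Icc (0 : ℝ) 1,
      t ∈ (LinearMap.toSpanSingleton ℝ V z) ⁻¹' Metric.ball (0 : V) ρ := fun t ht => by
    simpa using smul_mem_ball_of_mem_Icc hz ht
  have hder : ∀ t ∈ Icc (0 : ℝ) 1,
      HasDerivAt (h ∘ LinearMap.toSpanSingleton ℝ V z) (D (t • z) z) t := fun t ht =>
    (hD _ (smul_mem_ball_of_mem_Icc hz ht)).comp_hasDerivAt t (hasDerivAt_smul_const_id z t)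
  have m0 : (0 : ℝ) ∈ Icc (0 : ℝ) 1 := by simp
  have m1 : (1 : ℝ) ∈ Icc (0 : ℝ) 1 := by simp
  have e1 := hφ.slope_le_of_hasDerivAt (hm 0 m0) (hm 1 m1) zero_lt_one (hder 0 m0)
  have e2 := hφ.le_slope_of_hasDerivAt (hm 0 m0) (hm 1 m1) zero_lt_one (hder 1 m1)
  simp [slope_def_field, h0, hD0] at e1 e2
  exact ⟨e1, e2⟩

theorem norm_deriv_sub_le_of_lipschitz {D : V → V →L[ℝ] ℝ} {E : V → V →L[ℝ] V →L[ℝ] ℝ} {ρ M : ℝ}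
    (hE : ∀ z ∈ Metric.ball (0 : V) ρ, HasFDerivAt D (E z) z) (hD0 : D 0 = 0)
    (hM : ∀ z ∈ Metric.ball (0 : V) ρ, ‖E z - E 0‖ ≤ M * ‖z‖)
    {z : V} (hz : z ∈ Metric.ball (0 : V) ρ) : ‖D z - E 0 z‖ ≤ M / 2 * ‖z‖ ^ 2 := by
  have hder : ∀ t ∈ Icc (0 : ℝ) 1,
      HasDerivAt (fun t : ℝ => D (t • z) - t • E 0 z) (E (t • z) z - E 0 z) t := fun t ht =>
    ((hE _ (smul_mem_ball_of_mem_Icc hz ht)).comp_hasDerivAt t (hasDerivAt_smul_const_id z t)).sub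
      (hasDerivAt_smul_const_id (E 0 z) t)
  have hB : ∀ t : ℝ, HasDerivAt (fun t => M / 2 * ‖z‖ ^ 2 * t ^ 2) (M * ‖z‖ ^ 2 * t) t := by
    intro t
    convert! (hasDerivAt_pow 2 t).const_mul (M / 2 * ‖z‖ ^ 2) using 1
    simp
    ring
  have key := image_norm_le_of_norm_deriv_right_le_deriv_boundary (a := 0) (b := 1)
    (fun t ht => (hder t ht).continuousAt.continuousWithinAt)
    (fun t ht => (hder t (Ico_subset_Icc_self ht)).hasDerivWithinAt) (by simp [hD0]) hB
    (fun t ht => by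
      change ‖(E (t • z) - E 0) z‖ ≤ _
      refine ((E (t • z) - E 0).le_opNorm z).trans ?_
      have := hM _ (smul_mem_ball_of_mem_Icc hz (Ico_subset_Icc_self ht))
      rw [norm_smul, Real.norm_of_nonneg ht.1] at this
      calc _ ≤ M * (t * ‖z‖) * ‖z‖ := by gcongr
        _ = _ := by ring) (right_mem_Icc.2 zero_le_one)
  simpa using key

theorem abs_le_of_norm_deriv_le {h : V → ℝ} {D : V → V →L[ℝ] ℝ} {ρ L : ℝ}
    (hD : ∀ z ∈ Metric.ball (0 : V) ρ, HasFDerivAt h (D z) z) (h0 : h 0 = 0)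
    (hL : ∀ z ∈ Metric.ball (0 : V) ρ, ‖D z‖ ≤ L * ‖z‖)
    {z : V} (hz : z ∈ Metric.ball (0 : V) ρ) : |h z| ≤ L / 2 * ‖z‖ ^ 2 := by
  have hder : ∀ t ∈ Icc (0 : ℝ) 1, HasDerivAt (fun t : ℝ => h (t • z)) (D (t • z) z) t :=
    fun t ht =>
    (hD _ (smul_mem_ball_of_mem_Icc hz ht)).comp_hasDerivAt t (hasDerivAt_smul_const_id z t)
  have hB : ∀ t : ℝ, HasDerivAt (fun t => L / 2 * ‖z‖ ^ 2 * t ^ 2) (L * ‖z‖ ^ 2 * t) t := by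
    intro t
    convert! (hasDerivAt_pow 2 t).const_mul (L / 2 * ‖z‖ ^ 2) using 1
    simp
    ring
  have key := image_norm_le_of_norm_deriv_right_le_deriv_boundary (a := 0) (b := 1)
    (fun t ht => (hder t ht).continuousAt.continuousWithinAt)
    (fun t ht => (hder t (Ico_subset_Icc_self ht)).hasDerivWithinAt) (by simp [h0]) hB
    (fun t ht => by
      refine ((D (t • z)).le_opNorm z).trans ?_
      have := hL _ (smul_mem_ball_of_mem_Icc hz (Ico_subset_Icc_self ht))
      rw [norm_smul, Real.norm_of_nonneg ht.1] at this
      calc _ ≤ L * (t * ‖z‖) * ‖z‖ := by gcongr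
        _ = _ := by ring) (right_mem_Icc.2 zero_le_one)
  simpa using key

/-- Evaluate G(z)z ≥ 0 at z = ta, divide by t² and let t tend to 0 from the right. -/
theorem quadratic_nonneg_of_radial {G : V → V →L[ℝ] ℝ} {H : V →L[ℝ] V →L[ℝ] ℝ} {ρ M : ℝ}
    (hρ : 0 < ρ) (hG : ∀ z ∈ Metric.ball (0 : V) ρ, 0 ≤ G z z)
    (hH : ∀ z ∈ Metric.ball (0 : V) ρ, ‖G z - H z‖ ≤ M / 2 * ‖z‖ ^ 2) (a : V) : 0 ≤ H a a := by
  have hlim : Filter.Tendsto (fun t : ℝ => H a a + M / 2 * ‖a‖ ^ 3 * t)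
      (nhdsWithin 0 (Ioi 0)) (nhds (H a a + M / 2 * ‖a‖ ^ 3 * 0)) :=
    (by fun_prop : Continuous fun t : ℝ => H a a + M / 2 * ‖a‖ ^ 3 * t).continuousWithinAt
  rw [mul_zero, add_zero] at hlim
  have hball : ∀ᶠ t in nhdsWithin (0 : ℝ) (Ioi 0), t • a ∈ Metric.ball (0 : V) ρ := by
    have : Filter.Tendsto (fun t : ℝ => t • a) (nhds 0) (nhds ((0 : ℝ) • a)) :=
      (by fun_prop : Continuous fun t : ℝ => t • a).continuousAt
    rw [zero_smul] at this
    exact (this.eventually (Metric.ball_mem_nhds 0 hρ)).filter_mono nhdsWithin_le_nhds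
  refine ge_of_tendsto hlim ?_
  filter_upwards [hball, self_mem_nhdsWithin] with t ht (ht0 : 0 < t)
  have h1 := hG _ ht
  have h2 := (Real.le_norm_self _).trans (((G (t • a) - H (t • a)).le_opNorm (t • a)).trans
    (mul_le_mul_of_nonneg_right (hH _ ht) (norm_nonneg _)))
  have h3 : (G (t • a) - H (t • a)) (t • a) = G (t • a) (t • a) - t ^ 2 * H a a := by
    simp
    ring
  rw [h3, norm_smul, Real.norm_of_nonneg ht0.le] at h2
  have h4 : 0 ≤ t ^ 2 * (H a a + M / 2 * ‖a‖ ^ 3 * t) := by nlinarith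
  exact nonneg_of_mul_nonneg_right h4 (by positivity)

end Profile

/-! ### Construction of the cutoff and uniqueness of the normal -/

section Cutoff

variable {V : Type*} [NormedAddCommGroup V] [InnerProductSpace ℝ V] [FiniteDimensional ℝ V]
  [MeasurableSpace V] [BorelSpace V]
  {S : Set (V × ℝ)} {g : V → ℝ} {G : V → V →L[ℝ] ℝ} {H : V →L[ℝ] V →L[ℝ] ℝ} {ρ L M d : ℝ}

theorem IsLocalEpigraph.exists_isCutoffPatch (h : IsLocalEpigraph S g G H ρ L M) (hd : 0 < d)
    (hS : MeasurableSet S) (hvol : volume S ≠ 0) :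
    ∃ r η A B : ℝ, ∃ χ : V → ℝ, ∃ χ' : V → V →L[ℝ] ℝ, r < ρ ∧
      IsCutoffPatch S g d r η χ χ' A B := by
  have hρ := h.radius_pos
  have hL := h.L_nonneg
  -- With Lr ≤ 1 and r ≤ ρ/2, g is at most ρ/4 over the ball, so a patch of thickness ρ/2 stays
  -- below height ρ, inside the chart.
  obtain ⟨r, hr, hrρ, hrL⟩ : ∃ r : ℝ, 0 < r ∧ r ≤ ρ / 2 ∧ L * r ≤ 1 := by
    refine ⟨min (ρ / 2) (1 / (L + 1)), by positivity, min_le_left _ _, ?_⟩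
    calc L * min (ρ / 2) (1 / (L + 1)) ≤ L * (1 / (L + 1)) := by gcongr; exact min_le_right _ _
      _ ≤ 1 := by rw [mul_one_div, div_le_one (by positivity)]; linarith
  let f : ContDiffBump (0 : V) := ⟨r / 2, r, by positivity, by linarith⟩
  have hf : ContDiff ℝ 1 f := f.contDiff
  have hf' : Continuous (fderiv ℝ f) := hf.continuous_fderiv one_ne_zero
  obtain ⟨C, hC⟩ := hf'.bounded_above_of_compact_support (f.hasCompactSupport.fderiv ℝ)
  have hC0 : 0 ≤ C := (norm_nonneg _).trans (hC 0)
  have hsub : r < ρ := by linarith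
  have hle : ∀ z ∈ Metric.closedBall (0 : V) r, g z ≤ ρ / 4 := by
    intro z hz
    have h1 := h.le_sq z (Metric.closedBall_subset_ball hsub hz)
    rw [mem_closedBall_zero_iff] at hz
    have h2 : L / 2 * ‖z‖ ^ 2 ≤ L / 2 * r ^ 2 := by gcongr
    nlinarith
  -- The summands of `A` treat the two ways of leaving the region where the bump is 1: ‖z‖ > r/2
  -- forces Q ≥ r²/4, and s ≥ ρ/2 forces Q ≥ dρ. The derivative of the bump vanishes for ‖z‖ < r/2,
  -- and elsewhere (2‖z‖/r)⁴ ≥ 1, whence `B`.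
  refine ⟨r, ρ / 2, 4 / r ^ 2 + 1 / (d * ρ), C * (2 / r) ^ 4, f, fderiv ℝ f, hsub, ?_⟩
  refine ⟨hd, hr, by positivity, by positivity, by positivity, hS, hvol, ?_,
    fun z => (hf.differentiable one_ne_zero z).hasFDerivAt, hf', f.tsupport_eq.le,
    fun z => f.nonneg, fun z => f.le_one, ?_, ?_⟩
  · intro q hq
    have hz := Metric.closedBall_subset_ball hsub hq.1
    have h1 := h.nonneg _ hz
    have h2 := hle _ hq.1
    have h3 := hq.2.1
    have h4 := hq.2.2
    exact (h.mem_iff q.1 hz q.2 ⟨by linarith, by linarith⟩).2 (by linarith)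
  · intro z
    rcases lt_or_ge ‖z‖ (r / 2) with hz | hz
    · have : (f : V → ℝ) =ᶠ[nhds z] fun _ => 1 :=
        f.eventuallyEq_one_of_mem_ball (mem_ball_zero_iff.2 hz)
      rw [this.fderiv_eq, fderiv_fun_const, Pi.zero_apply, norm_zero]
      positivity
    · refine (hC z).trans ?_
      rw [mul_assoc, ← mul_pow]
      refine le_mul_of_one_le_right hC0 (one_le_pow₀ ?_)
      rw [div_mul_eq_mul_div, one_le_div hr]
      linarith
  · intro q hq
    have hs := h.snd_nonneg q hq
    have hQ := offsetSq_nonneg hd.le hs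
    rcases lt_or_ge (r / 2) ‖q.1‖ with h1 | h1
    · right
      have h2 := norm_fst_sq_le_offsetSq hd.le hs
      have h3 : (r / 2) ^ 2 ≤ offsetSq d q := le_trans (by gcongr) h2
      have h4 : 1 ≤ 4 / r ^ 2 * offsetSq d q := by
        rw [div_mul_eq_mul_div, one_le_div (by positivity)]
        linarith
      have h5 : 0 ≤ 1 / (d * ρ) * offsetSq d q := by positivity
      linarith
    rcases le_or_gt (ρ / 2) q.2 with h2 | h2
    · right
      have h3 := snd_le_offsetSq (d := d) (q := q)
      have h4 : 1 ≤ 1 / (d * ρ) * offsetSq d q := by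
        rw [div_mul_eq_mul_div, one_le_div (by positivity)]
        nlinarith
      have h5 : 0 ≤ 4 / r ^ 2 * offsetSq d q := by positivity
      linarith
    · left
      have hz : q.1 ∈ Metric.closedBall (0 : V) r := mem_closedBall_zero_iff.2 (by linarith)
      have hz' := Metric.closedBall_subset_ball hsub hz
      have h3 := (h.mem_iff q.1 hz' q.2 ⟨by linarith, by linarith⟩).1 hq
      have h4 := h.nonneg _ hz'
      exact ⟨⟨hz, by linarith, by linarith⟩,
        f.one_of_mem_closedBall (mem_closedBall_zero_iff.2 h1)⟩

/-- Test at the boundary point over z = ta: then t‖a‖² ≤ b g(ta) = O(t²), which forces a = 0 as t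
tends to 0. The sign of b is read off at the interior point (0, ρ/2). -/
theorem IsLocalEpigraph.normal_unique (h : IsLocalEpigraph S g G H ρ L M) {a : V} {b : ℝ}
    (hab : ∀ q ∈ S, inner ℝ a q.1 - b * q.2 ≤ 0) : a = 0 ∧ 0 ≤ b := by
  have hρ := h.radius_pos
  have hL := h.L_nonneg
  have hg : ∀ z ∈ Metric.ball (0 : V) ρ, g z < ρ → (z, g z) ∈ S := fun z hz hlt =>
    (h.mem_iff z hz _ ⟨by linarith [h.nonneg z hz], hlt⟩).2 le_rfl
  have h00 : g 0 = 0 := by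
    have := h.le_sq 0 (Metric.mem_ball_self hρ)
    have := h.nonneg 0 (Metric.mem_ball_self hρ)
    simp at *
    linarith
  refine ⟨?_, ?_⟩
  · by_contra hne
    have hpos : 0 < ‖a‖ ^ 2 := by positivity
    have hlim : Filter.Tendsto (fun t : ℝ => |b| * (L / 2) * ‖a‖ ^ 2 * t - ‖a‖ ^ 2)
        (nhdsWithin 0 (Ioi 0)) (nhds (|b| * (L / 2) * ‖a‖ ^ 2 * 0 - ‖a‖ ^ 2)) :=
      (by fun_prop : Continuous fun t : ℝ =>
        |b| * (L / 2) * ‖a‖ ^ 2 * t - ‖a‖ ^ 2).continuousWithinAt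
    have hball : ∀ᶠ t in nhdsWithin (0 : ℝ) (Ioi 0), t • a ∈ Metric.ball (0 : V) ρ := by
      have : Filter.Tendsto (fun t : ℝ => t • a) (nhds 0) (nhds ((0 : ℝ) • a)) :=
        (by fun_prop : Continuous fun t : ℝ => t • a).continuousAt
      rw [zero_smul] at this
      exact (this.eventually (Metric.ball_mem_nhds 0 hρ)).filter_mono nhdsWithin_le_nhds
    have hsmall : ∀ᶠ t in nhdsWithin (0 : ℝ) (Ioi 0), L / 2 * (t ^ 2 * ‖a‖ ^ 2) < ρ := by
      have : Filter.Tendsto (fun t : ℝ => L / 2 * (t ^ 2 * ‖a‖ ^ 2)) (nhds 0)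
          (nhds (L / 2 * ((0 : ℝ) ^ 2 * ‖a‖ ^ 2))) :=
        (by fun_prop : Continuous fun t : ℝ => L / 2 * (t ^ 2 * ‖a‖ ^ 2)).continuousAt
      exact (this.eventually (Iio_mem_nhds (by simpa using hρ))).filter_mono nhdsWithin_le_nhds
    have : 0 ≤ |b| * (L / 2) * ‖a‖ ^ 2 * 0 - ‖a‖ ^ 2 := by
      refine ge_of_tendsto hlim ?_
      filter_upwards [hball, hsmall, self_mem_nhdsWithin] with t ht hts (ht0 : 0 < t)
      have h1 := h.le_sq _ ht
      rw [norm_smul, Real.norm_of_nonneg ht0.le, mul_pow] at h1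
      have h2 := hab _ (hg _ ht (h1.trans_lt hts))
      simp only [real_inner_smul_right, real_inner_self_eq_norm_sq] at h2
      have h3 : b * g (t • a) ≤ |b| * (L / 2 * (t ^ 2 * ‖a‖ ^ 2)) :=
        mul_le_mul (le_abs_self b) h1 (h.nonneg _ ht) (abs_nonneg b)
      have h4 : 0 ≤ t * (|b| * (L / 2) * ‖a‖ ^ 2 * t - ‖a‖ ^ 2) := by linarith
      exact nonneg_of_mul_nonneg_right h4 ht0
    linarith
  · have hm : ((0 : V), ρ / 2) ∈ S :=
      (h.mem_iff 0 (Metric.mem_ball_self hρ) _ ⟨by linarith, by linarith⟩).2 (by linarith)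
    have := hab _ hm
    simp only [inner_zero_right] at this
    nlinarith

end Cutoff

/-! ### Transfer between the Euclidean space and chart coordinates -/

section Chart

variable {F E : Type*} [NormedAddCommGroup F] [InnerProductSpace ℝ F] [FiniteDimensional ℝ F]
  [MeasurableSpace F] [BorelSpace F] [NormedAddCommGroup E] [InnerProductSpace ℝ E]
  [FiniteDimensional ℝ E] [MeasurableSpace E] [BorelSpace E]

/-- The linear part of a chart, with the last coordinate reversed. -/
noncomputable def chartLinear (T : WithLp 2 (F × ℝ) ≃ₗᵢ[ℝ] E) : F × ℝ →L[ℝ] E :=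
  (T.toContinuousLinearEquiv : WithLp 2 (F × ℝ) →L[ℝ] E).comp
    ((WithLp.prodContinuousLinearEquiv 2 ℝ F ℝ).symm.toContinuousLinearMap.comp
      ((ContinuousLinearMap.fst ℝ F ℝ).prod (-ContinuousLinearMap.snd ℝ F ℝ)))

theorem chartLinear_apply (T : WithLp 2 (F × ℝ) ≃ₗᵢ[ℝ] E) (q : F × ℝ) :
    chartLinear T q = T (WithLp.toLp 2 (q.1, -q.2)) := rfl

/-- The parametrization `(z, s) ↦ p + T (z, -s)` as a measurable equivalence. -/
noncomputable def chartEquiv (T : WithLp 2 (F × ℝ) ≃ₗᵢ[ℝ] E) (p : E) : F × ℝ ≃ᵐ E :=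
  (((MeasurableEquiv.refl F).prodCongr (MeasurableEquiv.neg ℝ)).trans
    ((MeasurableEquiv.toLp 2 (F × ℝ)).trans T.toMeasurableEquiv)).trans (MeasurableEquiv.addRight p)

theorem chartEquiv_apply (T : WithLp 2 (F × ℝ) ≃ₗᵢ[ℝ] E) (p : E) (q : F × ℝ) :
    chartEquiv T p q = chartLinear T q + p := rfl

theorem measurePreserving_chartEquiv (T : WithLp 2 (F × ℝ) ≃ₗᵢ[ℝ] E) (p : E) :
    MeasurePreserving (chartEquiv T p) :=
  (measurePreserving_add_right volume p).comp (T.measurePreserving.comp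
    ((WithLp.volume_preserving_toLp F ℝ).comp
      ((MeasurePreserving.id volume).prod (Measure.measurePreserving_neg volume))))

theorem inner_chartLinear (T : WithLp 2 (F × ℝ) ≃ₗᵢ[ℝ] E) (q q' : F × ℝ) :
    inner ℝ (chartLinear T q) (chartLinear T q') = inner ℝ q.1 q'.1 + q.2 * q'.2 := by
  rw [chartLinear_apply, chartLinear_apply, T.inner_map_map, WithLp.prod_inner_apply]
  simp [mul_comm]

theorem norm_sq_chartLinear (T : WithLp 2 (F × ℝ) ≃ₗᵢ[ℝ] E) (q : F × ℝ) :
    ‖chartLinear T q‖ ^ 2 = ‖q.1‖ ^ 2 + q.2 ^ 2 := by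
  rw [← real_inner_self_eq_norm_sq, inner_chartLinear, real_inner_self_eq_norm_sq, sq q.2]

/-- The chart is an isometry, so it preserves volume, and the squared distance to the centre is d² +
Q; the factor exp(-d²/(2δ)) cancels on normalizing. -/
theorem smoothedProj_sub_eq {n : ℕ} (T : WithLp 2 (F × ℝ) ≃ₗᵢ[ℝ] EuclideanSpace ℝ (Fin n))
    {C : Set (EuclideanSpace ℝ (Fin n))} (hC : MeasurableSet C)
    {S : Set (F × ℝ)} (p : EuclideanSpace ℝ (Fin n)) (hS : S = chartEquiv T p ⁻¹' C)
    (hvol : volume S ≠ 0) {d δ : ℝ} (hδ : 0 < δ)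
    (h1 : Integrable (fun q : F × ℝ => q.1) (condGauss S d δ))
    (h2 : Integrable (fun q : F × ℝ => q.2) (condGauss S d δ)) :
    smoothedProj C δ (chartLinear T (0, -d) + p) - p =
      chartLinear T (∫ q, q.1 ∂(condGauss S d δ), ∫ q, q.2 ∂(condGauss S d δ)) := by
  have := isProbabilityMeasure_condGauss hvol d hδ
  have hint : Integrable (fun q : F × ℝ => q) (condGauss S d δ) := h1.prodMk h2
  have hmain : smoothedProj C δ (chartLinear T (0, -d) + p) =
      ∫ q, chartEquiv T p q ∂(condGauss S d δ) := by
    have hexp : ∀ q : F × ℝ, Real.exp (-((2 * δ)⁻¹ *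
        ‖chartEquiv T p q - (chartLinear T (0, -d) + p)‖ ^ 2)) =
        Real.exp (-((2 * δ)⁻¹ * d ^ 2)) * Real.exp (-((2 * δ)⁻¹ * offsetSq d q)) := by
      intro q
      rw [chartEquiv_apply, add_sub_add_right_eq_sub, ← map_sub, norm_sq_chartLinear,
        ← Real.exp_add]
      congr 1
      simp only [offsetSq, Prod.fst_sub, Prod.snd_sub, sub_zero]
      ring
    have hemb := (chartEquiv T p).measurableEmbedding
    have hmp := measurePreserving_chartEquiv T p
    rw [smoothedProj_eq_integral_tilted hC hδ, integral_tilted, integral_condGauss,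
      ← hmp.setIntegral_preimage_emb hemb, ← hmp.setIntegral_preimage_emb hemb, ← hS,
      ← integral_smul]
    simp only [hexp, integral_const_mul]
    refine integral_congr_ae (ae_of_all _ fun q => ?_)
    simp only [smul_smul]
    congr 1
    rw [mul_div_mul_left _ _ (Real.exp_pos _).ne', div_eq_inv_mul]
  rw [hmain]
  simp only [chartEquiv_apply]
  rw [integral_add ((chartLinear T).integrable_comp hint) (integrable_const p), integral_const,
    probReal_univ, one_smul, add_sub_cancel_right, (chartLinear T).integral_comp_comm hint]
  congr 1
  exact integral_pair h1 h2

/-- The supporting hyperplane at `p` puts S in the upper half-space, and convexity gives stability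
under halving, since q is the midpoint of 2q and 0. The remaining fields are Taylor bounds for -h.
-/
theorem isLocalEpigraph_of_profile (T : WithLp 2 (F × ℝ) ≃ₗᵢ[ℝ] E) {C : Set E} {p ν : E}
    (hconv : Convex ℝ C) (hp : p ∈ C) (hν : ∀ y ∈ C, inner ℝ ν (y - p) ≤ 0)
    (hTν : ν = chartLinear T (0, -1)) {h : F → ℝ} {ρ L M : ℝ} (hρ : 0 < ρ) (hM : 0 ≤ M)
    (hprof : IsC21Profile h ρ L M)
    (hmem : ∀ z ∈ Metric.ball (0 : F) ρ, ∀ t ∈ Ioo (-ρ) ρ,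
      (T (WithLp.toLp 2 (z, t)) + p ∈ C ↔ t ≤ h z)) :
    IsLocalEpigraph (chartEquiv T p ⁻¹' C) (fun z => -h z) (fun z => -fderiv ℝ h z)
      (-fderiv ℝ (fderiv ℝ h) 0) ρ L M := by
  obtain ⟨hconc, hsm, h0, hD0, hL, hlip⟩ := hprof
  have hm0 : (0 : F) ∈ Metric.ball (0 : F) ρ := Metric.mem_ball_self hρ
  have hD : ∀ z ∈ Metric.ball (0 : F) ρ, HasFDerivAt h (fderiv ℝ h z) z := fun z hz =>
    ((hsm.differentiableOn two_ne_zero).differentiableAt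
      (Metric.isOpen_ball.mem_nhds hz)).hasFDerivAt
  have hsm' : ContDiffOn ℝ 1 (fderiv ℝ h) (Metric.ball 0 ρ) :=
    hsm.fderiv_of_isOpen Metric.isOpen_ball (by norm_num)
  have hE : ∀ z ∈ Metric.ball (0 : F) ρ,
      HasFDerivAt (fderiv ℝ h) (fderiv ℝ (fderiv ℝ h) z) z := fun z hz =>
    ((hsm'.differentiableOn one_ne_zero).differentiableAt
      (Metric.isOpen_ball.mem_nhds hz)).hasFDerivAt
  have hgrad : ∀ z ∈ Metric.ball (0 : F) ρ, ‖fderiv ℝ h z‖ ≤ L * ‖z‖ := fun z hz => by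
    have := (convex_ball (0 : F) ρ).norm_image_sub_le_of_norm_fderiv_le
      (fun y hy => (hE y hy).differentiableAt) hL hm0 hz
    rwa [hD0, sub_zero, sub_zero] at this
  have hrem := fun z hz => norm_deriv_sub_le_of_lipschitz (M := M) hE hD0
    (fun z hz => by simpa using hlip z hz 0 hm0) (z := z) hz
  have hcrit := fun z hz => hconc.le_and_deriv_le_of_critical hD h0 hD0 (z := z) hz
  have hremneg : ∀ z ∈ Metric.ball (0 : F) ρ,
      ‖-fderiv ℝ h z - (-fderiv ℝ (fderiv ℝ h) 0) z‖ ≤ M / 2 * ‖z‖ ^ 2 := fun z hz => by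
    rw [neg_apply, neg_sub_neg, norm_sub_rev]
    exact hrem z hz
  have hrad : ∀ z ∈ Metric.ball (0 : F) ρ, 0 ≤ (-fderiv ℝ h z) z := fun z hz => by
    rw [neg_apply, neg_nonneg]
    exact (hcrit z hz).2.trans (hcrit z hz).1
  -- The sign of `L` is not assumed; it follows from the Hessian bound at 0.
  refine ⟨hρ, (norm_nonneg (fderiv ℝ (fderiv ℝ h) 0)).trans (hL 0 hm0), hM, ?_, ?_, ?_, fun z hz => (hD z hz).neg,
    hsm'.continuousOn.neg, fun z hz => neg_nonneg.2 (hcrit z hz).1, ?_, ?_, hremneg, hrad,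
    quadratic_nonneg_of_radial hρ hrad hremneg⟩
  · intro q hq
    have := hν _ hq
    rw [chartEquiv_apply, add_sub_cancel_right, hTν, inner_chartLinear] at this
    simpa using this
  · intro q hq
    have h1 := hconv hq hp (by norm_num : (0 : ℝ) ≤ 1 / 2) (by norm_num : (0 : ℝ) ≤ 1 / 2)
      (by norm_num)
    have h2 : (1 / 2 : ℝ) • chartEquiv T p ((2 : ℝ) • q) + (1 / 2 : ℝ) • p =
        chartEquiv T p q := by
      rw [chartEquiv_apply, chartEquiv_apply, map_smul]
      module
    rw [h2] at h1
    exact h1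
  · intro z hz t ht
    have := hmem z hz (-t) ⟨by linarith [ht.2], by linarith [ht.1]⟩
    change T (WithLp.toLp 2 (z, -t)) + p ∈ C ↔ _
    rw [this]
    constructor <;> intro <;> linarith
  · intro z hz
    exact (neg_le_abs _).trans (abs_le_of_norm_deriv_le hD h0 hgrad hz)
  · intro z hz
    rw [norm_neg]
    exact hgrad z hz

theorem inner_sub_metricProj_nonpos {n : ℕ} {C : Set (EuclideanSpace ℝ (Fin n))}
    (hC : IsClosed C) (hconv : Convex ℝ C) (hne : C.Nonempty) (x : EuclideanSpace ℝ (Fin n)) :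
    ∀ y ∈ C, inner ℝ (x - metricProj C x) (y - metricProj C x) ≤ 0 := by
  have hq := isNearestPoint_metricProj hC hne x
  refine (norm_eq_iInf_iff_real_inner_le_zero hconv hq.1).1 ?_
  rw [← dist_eq_norm, hq.2, Metric.infDist_eq_iInf]
  simp only [dist_eq_norm]

theorem isOutwardUnitNormal_projNormal {n : ℕ} {C : Set (EuclideanSpace ℝ (Fin n))}
    (hC : IsClosed C) (hconv : Convex ℝ C) (hne : C.Nonempty) {x : EuclideanSpace ℝ (Fin n)}
    (hx : x ∉ C) : IsOutwardUnitNormal C (metricProj C x) (projNormal C x) := by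
  have hd : 0 < Metric.infDist x C := (hC.notMem_iff_infDist_pos hne).1 hx
  refine ⟨?_, fun y hy => ?_⟩
  · rw [projNormal, norm_smul, ← dist_eq_norm, (isNearestPoint_metricProj hC hne x).2,
      Real.norm_of_nonneg (inv_nonneg.2 hd.le), inv_mul_cancel₀ hd.ne']
  · rw [projNormal, real_inner_smul_left]
    exact mul_nonpos_of_nonneg_of_nonpos (inv_nonneg.2 hd.le)
      (inner_sub_metricProj_nonpos hC hconv hne x y hy)

/-- The chart brings its own unit normal; this identifies it with the direction from the projection
to `x`. -/
theorem IsLocalEpigraph.eq_chartLinear_of_isOutwardUnitNormal {n : ℕ}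
    {T : WithLp 2 (F × ℝ) ≃ₗᵢ[ℝ] EuclideanSpace ℝ (Fin n)}
    {C : Set (EuclideanSpace ℝ (Fin n))} {p ν : EuclideanSpace ℝ (Fin n)}
    {g : F → ℝ} {G : F → F →L[ℝ] ℝ} {H : F →L[ℝ] F →L[ℝ] ℝ} {ρ L M : ℝ}
    (h : IsLocalEpigraph (chartEquiv T p ⁻¹' C) g G H ρ L M) (hν : IsOutwardUnitNormal C p ν) :
    ν = chartLinear T (0, -1) := by
  obtain ⟨q, rfl⟩ : ∃ q : F × ℝ, chartLinear T q = ν :=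
    ⟨((T.symm ν).fst, -(T.symm ν).snd), by
      rw [chartLinear_apply, neg_neg]
      exact T.apply_symm_apply ν⟩
  obtain ⟨h1, h2⟩ := h.normal_unique (a := q.1) (b := -q.2) fun q' hq' => by
    have := hν.2 _ hq'
    rw [chartEquiv_apply, add_sub_cancel_right, inner_chartLinear] at this
    linarith
  have h3 := norm_sq_chartLinear T q
  rw [hν.1, h1, norm_zero] at h3
  have h4 : q.2 = -1 := by nlinarith
  rw [show q = (0, -1) from Prod.ext h1 h4]

end Chart

/-! ### The main theorem -/

theorem theorem4p3 (n : ℕ) (C : Set (EuclideanSpace ℝ (Fin n)))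
    (hclosed : IsClosed C) (hconvex : Convex ℝ C) (hint : (interior C).Nonempty)
    (x : EuclideanSpace ℝ (Fin n)) (hx : x ∉ C) (ρ L M : ℝ)
    (hchart : HasLocalC21Chart C (metricProj C x) ρ L M) :
    ∃ δ₀ > 0, ∃ K Kν Kτ : ℝ, ∀ δ : ℝ, 0 < δ → δ < δ₀ →
      ‖smoothedProj C δ x - metricProj C x‖ ≤ K * δ ∧
      |inner ℝ (projNormal C x) (smoothedProj C δ x - metricProj C x)| ≤
        (L * ((n : ℝ) - 1) / 2 + 1 / Metric.infDist x C) * δ + Kν * δ ^ (3 / 2 : ℝ) ∧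
      ‖(smoothedProj C δ x - metricProj C x) -
          inner ℝ (projNormal C x) (smoothedProj C δ x - metricProj C x) • projNormal C x‖ ≤
        (M * ((n : ℝ) ^ 2 - 1) * Metric.infDist x C / 6) * δ + Kτ * δ ^ 2 := by
  have hne : C.Nonempty := hint.mono interior_subset
  -- In dimension 0 no point lies outside a nonempty set; n ≥ 1 makes the truncated difference `n -
  -- 1` a true one.
  have hn : 1 ≤ n := by
    rcases Nat.eq_zero_or_pos n with rfl | hn
    · obtain ⟨y, hy⟩ := hne
      exact absurd (Subsingleton.elim x y ▸ hy) hx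
    · exact hn
  have hd : 0 < Metric.infDist x C := (hclosed.notMem_iff_infDist_pos hne).1 hx
  have hp := (isNearestPoint_metricProj hclosed hne x).1
  have hnormal := isOutwardUnitNormal_projNormal hclosed hconvex hne hx
  have hxp : x = Metric.infDist x C • projNormal C x + metricProj C x := by
    rw [projNormal, smul_inv_smul₀ hd.ne', sub_add_cancel]
  obtain ⟨-, hρ, hM, Φ, ν, h, hΦp, hν, hΦν, hprof, hmem⟩ := hchart
  set p := metricProj C x
  set d := Metric.infDist x C
  set T := Φ.linearIsometryEquiv.symm
  have hTν : ν = chartLinear T (0, -1) := by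
    rw [chartLinear_apply, neg_neg, ← hΦν]
    exact (Φ.linearIsometryEquiv.symm_apply_apply ν).symm
  have hΦT : ∀ w, Φ.symm w = T w + p := by
    intro w
    rw [Φ.symm_apply_eq]
    have := Φ.map_vadd p (T w)
    rw [vadd_eq_add, vadd_eq_add, hΦp, add_zero] at this
    rw [this]
    exact (Φ.linearIsometryEquiv.apply_symm_apply w).symm
  have hloc := isLocalEpigraph_of_profile T hconvex hp hν.2 hTν hρ hM hprof
    (fun z hz t ht => by rw [← hΦT]; exact hmem z hz t ht)
  have hN : projNormal C x = chartLinear T (0, -1) :=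
    hloc.eq_chartLinear_of_isOutwardUnitNormal hnormal
  set S := chartEquiv T p ⁻¹' C with hS
  have hSm : MeasurableSet S := (chartEquiv T p).measurable hclosed.measurableSet
  have hvol : volume S ≠ 0 := by
    rw [hS, (measurePreserving_chartEquiv T p).measure_preimage_equiv]
    exact ((isOpen_interior.measure_pos volume hint).trans_le (measure_mono interior_subset)).ne'
  obtain ⟨r, η, A, B, χ, χ', hr, hχ⟩ := hloc.exists_isCutoffPatch hd hSm hvol
  obtain ⟨K₁, K₂, hK⟩ := condGauss_mean_bounds hloc hχ hr
  have hcast : ((Module.finrank ℝ (EuclideanSpace ℝ (Fin (n - 1))) : ℕ) : ℝ) = n - 1 := by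
    rw [finrank_euclideanSpace_fin, Nat.cast_sub hn, Nat.cast_one]
  simp only [hcast] at hK
  have hxd : x = chartLinear T (0, -d) + p := by
    rw [hxp, hN, ← map_smul]
    simp
  refine ⟨1, one_pos, |d * (M / 2) * (n - 1)| + |K₁| + (|L * (n - 1) / 2 + 1 / d| + |K₂|), |K₂|,
    K₁, fun δ hδ hδ1 => ?_⟩
  obtain ⟨i1, i2, b1, b2⟩ := hK δ hδ hδ1.le
  have hv : smoothedProj C δ x - p =
      chartLinear T (∫ q, q.1 ∂(condGauss S d δ), ∫ q, q.2 ∂(condGauss S d δ)) := by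
    have := smoothedProj_sub_eq T hclosed.measurableSet p hS hvol hδ i1 i2
    rwa [← hxd] at this
  set a := ∫ q, q.1 ∂(condGauss S d δ)
  set s := ∫ q, q.2 ∂(condGauss S d δ)
  have hinner : inner ℝ (projNormal C x) (smoothedProj C δ x - p) = -s := by
    rw [hv, hN, inner_chartLinear]
    simp
  have htan : smoothedProj C δ x - p - (-s) • projNormal C x = chartLinear T (a, 0) := by
    rw [hv, hN, ← map_smul, ← map_sub]
    simp
  have hta : ‖chartLinear T (a, 0)‖ = ‖a‖ := by
    rw [← sq_eq_sq₀ (norm_nonneg _) (norm_nonneg _), norm_sq_chartLinear]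
    simp
  have hδ2 : δ ^ 2 ≤ δ := by nlinarith
  rw [hinner, htan, hta, abs_neg]
  refine ⟨?_, ?_, ?_⟩
  · have h1 : ‖smoothedProj C δ x - p‖ ≤ ‖a‖ + |s| := by
      rw [hv]
      refine abs_le_of_sq_le_sq' ?_ (by positivity) |>.2
      rw [norm_sq_chartLinear]
      nlinarith [mul_nonneg (norm_nonneg a) (abs_nonneg s), sq_abs s]
    have h2 : ∀ u v : ℝ, u * δ + v * δ ^ 2 ≤ (|u| + |v|) * δ := fun u v => by
      have e1 : u * δ ≤ |u| * δ := by gcongr; exact le_abs_self u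
      have e2 : v * δ ^ 2 ≤ |v| * δ := by
        calc v * δ ^ 2 ≤ |v| * δ ^ 2 := by gcongr; exact le_abs_self v
          _ ≤ _ := by gcongr
      linarith
    have h3 := h2 (d * (M / 2) * (n - 1)) K₁
    have h4 := h2 (L * (n - 1) / 2 + 1 / d) K₂
    linarith
  · refine b2.trans ?_
    -- This is where δ < 1 weakens the quadratic error to the stated power.
    have h1 : δ ^ 2 ≤ δ ^ (3 / 2 : ℝ) := by
      rw [← Real.rpow_two]
      exact Real.rpow_le_rpow_of_exponent_ge hδ hδ1.le (by norm_num)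
    have h2 : K₂ * δ ^ 2 ≤ |K₂| * δ ^ (3 / 2 : ℝ) :=
      mul_le_mul (le_abs_self _) h1 (by positivity) (abs_nonneg _)
    linarith
  · refine b1.trans ?_
    -- Since (n² - 1) - 3(n - 1) = (n - 1)(n - 2), this is the comparison of dM(n - 1)/2 with M(n² -
    -- 1)d/6. The product is nonnegative at every integer n ≥ 1, though not between 1 and 2.
    have h1 : (0 : ℝ) ≤ ((n : ℝ) - 1) * (n - 2) := by
      rcases Nat.lt_or_ge n 2 with h | h
      · have : n = 1 := by omega
        simp [this]
      · have : (2 : ℝ) ≤ n := by exact_mod_cast h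
        exact mul_nonneg (by linarith) (by linarith)
    have h2 := mul_nonneg (mul_nonneg (mul_nonneg hM hd.le) hδ.le) h1
    linarith
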